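/- For a graph $G$ (finite, simple, undirected), let $R_3(G)$ denote the three-color diagonal Ramsey number: the smallest integer $n$ such that every coloring of the edges of the complete graph $K_n$ with $3$ colors contains a monochromatic copy of $G$, that is, for some color the graph formed by the edges of that color has a (not necessarily induced) subgraph isomorphic to $G$. Let $P_k$ denote the path on $k$ vertices. Then $$R_3(P_7)=13 \qquad\text{and}\qquad R_3(P_9)=17.$$ -/

import Mathlib

/-- `RamseyArrows n G`: for every coloring of the edges of the complete graph `K_n` with `k` colors
there is a color `i` such that the graph formed by the edges of color `i` contains a
(not necessarily induced) subgraph isomorphic to `G i`. -/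
def RamseyArrows {k : ℕ} {V : Fin k → Type*} (n : ℕ) (G : (i : Fin k) → SimpleGraph (V i)) : Prop :=
  ∀ C : SimpleGraph.TopEdgeLabeling (Fin n) (Fin k),
    ∃ i : Fin k, (G i).IsContained (C.labelGraph i)

/-- `IsRamseyNumber G N`: the multicolor Ramsey number `R(G_1, ..., G_k)` exists and equals `N`,
i.e. `N` is the smallest `n` with `RamseyArrows n G`. -/
def IsRamseyNumber {k : ℕ} {V : Fin k → Type*} (G : (i : Fin k) → SimpleGraph (V i)) (N : ℕ) : Prop :=
  IsLeast {n : ℕ | RamseyArrows n G} N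

/-- `IsDiagonalRamseyNumber k G N`: the diagonal Ramsey number `R_k(G) = R(G, ..., G)`
with `k` colors exists and equals `N`. -/
def IsDiagonalRamseyNumber {V : Type*} (k : ℕ) (G : SimpleGraph V) (N : ℕ) : Prop :=
  IsRamseyNumber (fun _ : Fin k => G) N

/-! Write `2 * m + 1` for the number of vertices of the path, with `m = 3` or `m = 4`. For the lower
bound, four blocks of `m` vertices are coloured along the three perfect matchings of the complete
graph on the blocks. Each colour then lives on two separate sets of `2 * m` vertices
(`not_ramseyArrows`).

For the upper bound on `4 * m + 1` vertices it suffices that a colour without the path has fewer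
than a third of all edges (`ramseyArrows_of_degSum_lt`). Two tools give this. A connected graph on
at least `2 * m + 1` vertices without the path has few edges: Pósa's closing argument limits its
`m`-core to between `m + 1` and `2 * m - 1` vertices, and vertices outside the core are peeled off
at low degree (`degSum_le_of_pathFree_seven`, `degSum_le_of_pathFree_nine`). A union of components
of medium size is impossible, since the other two colours would cover a large complete bipartite
graph, where one of them has the path (`bipartite_ramsey`). What is left is one large component with
a small remainder, or only small pieces.

On 17 vertices the connected case just misses the required bound. A colour with too many edges has a
core of five vertices and an independent set of the other twelve (`core_compl_independent`). The
other two colours then share all edges among these twelve, and each has fewer than half of them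
(`ramsey_two_colors_nine`), a contradiction. -/

namespace RamseyPath

open Finset

set_option linter.unusedSectionVars false

/-! ### Paths by vertex set, Pósa's crossing argument, traceable sets. -/

section

variable {V : Type*} [DecidableEq V]

/-- `SpanPath G S a b`: there is a path of `G` from `a` to `b` whose vertex set is exactly `S`. -/
inductive SpanPath (G : SimpleGraph V) : Finset V → V → V → Prop
  | single (a : V) : SpanPath G {a} a a
  | cons {a b c : V} {S : Finset V} :
      a ∉ S → G.Adj a b → SpanPath G S b c → SpanPath G (insert a S) a c

namespace SpanPath

variable {G : SimpleGraph V} {S T : Finset V} {a b c d : V}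

theorem left_mem (h : SpanPath G S a b) : a ∈ S := by
  cases h <;> simp

theorem right_mem (h : SpanPath G S a b) : b ∈ S := by
  induction h with
  | single a => simp
  | cons _ _ _ ih => exact mem_insert_of_mem ih

theorem append (h₁ : SpanPath G S a b) (h₂ : SpanPath G T c d) (hd : Disjoint S T)
    (hbc : G.Adj b c) : SpanPath G (S ∪ T) a d := by
  induction h₁ with
  | single a =>
    rw [← insert_eq]
    exact cons (by simpa using hd) hbc h₂
  | @cons x y z S hx hxy _ ih =>
    rw [disjoint_insert_left] at hd
    rw [insert_union]
    exact cons (by simp [hx, hd.1]) hxy (ih hd.2 hbc)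

theorem symm (h : SpanPath G S a b) : SpanPath G S b a := by
  induction h with
  | single a => exact single a
  | @cons x y z S hx hxy _ ih =>
    have := ih.append (single x) (by simpa using hx) hxy.symm
    rwa [union_comm, ← insert_eq] at this

theorem snoc (h : SpanPath G S a b) (hc : c ∉ S) (hbc : G.Adj b c) :
    SpanPath G (insert c S) a c :=
  (cons hc hbc.symm h.symm).symm

theorem exists_isPath (h : SpanPath G S a b) :
    ∃ w : G.Walk a b, w.IsPath ∧ w.support.toFinset = S := by
  induction h with
  | single a => exact ⟨.nil, by simp, by simp⟩
  | @cons x y z S hx hxy _ ih =>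
    obtain ⟨w, hw, hS⟩ := ih
    refine ⟨.cons hxy w, ?_, by simp [hS]⟩
    rw [SimpleGraph.Walk.cons_isPath_iff]
    refine ⟨hw, fun h => hx ?_⟩
    rw [← hS]
    simpa using h

theorem pathGraph_isContained (h : SpanPath G S a b) {k : ℕ} (hk : k ≤ S.card) :
    (SimpleGraph.pathGraph k).IsContained G := by
  obtain ⟨w, hw, rfl⟩ := h.exists_isPath
  rw [List.toFinset_card_of_nodup hw.support_nodup, SimpleGraph.Walk.length_support] at hk
  refine SimpleGraph.IsContained.trans ?_ hw.isContained_pathGraph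
  refine ⟨⟨⟨Fin.castLE hk, ?_⟩, Fin.castLE_injective hk⟩⟩
  intro u v huv
  simpa [SimpleGraph.pathGraph_adj] using huv

theorem exists_of_isChain (l : List V) (hl : l.Nodup) (hc : l.IsChain G.Adj) (hne : l ≠ []) :
    ∃ b, SpanPath G l.toFinset (l.head hne) b := by
  induction l with
  | nil => exact absurd rfl hne
  | cons x l ih =>
    cases l with
    | nil => exact ⟨x, by simpa using single (G := G) x⟩
    | cons y l =>
      obtain ⟨b, hb⟩ := ih hl.of_cons hc.tail (by simp)
      rw [List.isChain_cons_cons] at hc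
      refine ⟨b, ?_⟩
      rw [List.toFinset_cons]
      refine cons ?_ hc.1 hb
      rw [List.mem_toFinset]
      exact (List.nodup_cons.1 hl).1

/-- A path splits at any of its vertices other than the last one. -/
theorem split (h : SpanPath G S a b) (hc : c ∈ S) (hcb : c ≠ b) :
    ∃ S₁ S₂ d, S = S₁ ∪ S₂ ∧ Disjoint S₁ S₂ ∧ SpanPath G S₁ a c ∧ SpanPath G S₂ d b ∧
      G.Adj c d := by
  induction h with
  | single a => exact absurd (by simpa using hc) hcb
  | @cons x y z S hx hxy hp ih =>
    by_cases hcx : c = x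
    · subst hcx
      exact ⟨{c}, S, y, insert_eq _ _, by simpa using hx, single c, hp, hxy⟩
    · obtain ⟨S₁, S₂, d, rfl, hd, h₁, h₂, hcd⟩ := ih (by simpa [hcx] using hc) hcb
      refine ⟨insert x S₁, S₂, d, (insert_union _ _ _).symm, ?_, cons ?_ hxy h₁, h₂, hcd⟩
      · rw [disjoint_insert_left]
        exact ⟨fun h => hx (mem_union_right _ h), hd⟩
      · exact fun h => hx (mem_union_left _ h)

/-- Pósa's crossing argument: if `A` and `B` are large sets of vertices of a path, some vertex of
`B` is immediately followed by a vertex of `A`. -/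
theorem crossing (h : SpanPath G S a b) {A B : Finset V} (hA : A ⊆ S) (hB : B ⊆ S)
    (haA : a ∉ A) (hbB : b ∉ B) (hcard : S.card ≤ A.card + B.card) :
    ∃ S₁ S₂ c d, S = S₁ ∪ S₂ ∧ Disjoint S₁ S₂ ∧ SpanPath G S₁ a c ∧ SpanPath G S₂ d b ∧
      G.Adj c d ∧ c ∈ B ∧ d ∈ A := by
  induction h generalizing A B with
  | single a =>
    rw [subset_singleton_iff] at hA hB
    have h1 : A = ∅ := hA.resolve_right (by rintro rfl; simp at haA)
    have h2 : B = ∅ := hB.resolve_right (by rintro rfl; simp at hbB)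
    subst h1 h2
    simp at hcard
  | @cons x y z S hx hxy hp ih =>
    by_cases hxB : x ∈ B ∧ y ∈ A
    · exact ⟨{x}, S, x, y, insert_eq _ _, by simpa using hx, single x, hp, hxy, hxB.1, hxB.2⟩
    · have h1 : A.erase y ⊆ S := fun v hv => by
        have hv' := mem_erase.1 hv
        have := hA hv'.2
        rcases mem_insert.1 this with rfl | h
        · exact absurd hv'.2 haA
        · exact h
      have h2 : B.erase x ⊆ S := fun v hv => by
        have hv' := mem_erase.1 hv
        exact (mem_insert.1 (hB hv'.2)).resolve_left hv'.1
      -- Passing to the tail shortens the path by one vertex and costs at most one element of `A`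
      -- and `B` together, since `x ∈ B` and `y ∈ A` do not both hold.
      have hcard' : S.card ≤ (A.erase y).card + (B.erase x).card := by
        rw [card_insert_of_notMem hx] at hcard
        by_cases hxB' : x ∈ B
        · have hyA : y ∉ A := fun h => hxB ⟨hxB', h⟩
          rw [erase_eq_of_notMem hyA, card_erase_of_mem hxB']
          omega
        · rw [erase_eq_of_notMem hxB']
          have := pred_card_le_card_erase (s := A) (a := y)
          omega
      obtain ⟨S₁, S₂, c, d, rfl, hd, h₁, h₂, hcd, hcB, hdA⟩ :=
        ih h1 h2 (by simp) (fun h => hbB (mem_of_mem_erase h)) hcard'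
      refine ⟨insert x S₁, S₂, c, d, (insert_union _ _ _).symm, ?_, cons ?_ hxy h₁, h₂, hcd,
        mem_of_mem_erase hcB, mem_of_mem_erase hdA⟩
      · rw [disjoint_insert_left]
        exact ⟨fun h => hx (mem_union_right _ h), hd⟩
      · exact fun h => hx (mem_union_left _ h)

/-- An initial segment of a path that contains a given set of vertices and ends in that set. -/
theorem exists_prefix (h : SpanPath G S a b) {N : Finset V} (hN : N ⊆ S) (hne : N.Nonempty) :
    ∃ w ∈ N, ∃ S₁ ⊆ S, SpanPath G S₁ a w ∧ N ⊆ S₁ := by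
  induction h generalizing N with
  | single a =>
    have := (subset_singleton_iff.1 hN).resolve_left hne.ne_empty
    subst this
    exact ⟨a, by simp, {a}, Subset.rfl, single a, Subset.rfl⟩
  | @cons x y z S hx hxy hp ih =>
    have h2 : N.erase x ⊆ S := fun v hv => by
      have hv' := mem_erase.1 hv
      exact (mem_insert.1 (hN hv'.2)).resolve_left hv'.1
    by_cases hne' : (N.erase x).Nonempty
    · obtain ⟨w, hw, S₁, hS₁, hp₁, hN₁⟩ := ih h2 hne'
      refine ⟨w, mem_of_mem_erase hw, insert x S₁, insert_subset_insert _ hS₁,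
        cons (fun h => hx (hS₁ h)) hxy hp₁, ?_⟩
      rwa [subset_insert_iff]
    · rw [not_nonempty_iff_eq_empty, erase_eq_empty_iff] at hne'
      have := hne'.resolve_left hne.ne_empty
      subst this
      exact ⟨x, by simp, {x}, by simp, single x, Subset.rfl⟩

end SpanPath

/-- `G` has no path with `k` vertices. -/
def PathFree (G : SimpleGraph V) (k : ℕ) : Prop :=
  ∀ S a b, SpanPath G S a b → S.card < k

theorem pathFree_of_not_isContained {G : SimpleGraph V} {k : ℕ}
    (h : ¬ (SimpleGraph.pathGraph k).IsContained G) : PathFree G k := fun S a b hp => by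
  by_contra hlt
  exact h (hp.pathGraph_isContained (not_lt.1 hlt))

theorem PathFree.length_lt {G : SimpleGraph V} {k : ℕ} (h : PathFree G k) (hk : 0 < k)
    (l : List V) (hl : l.Nodup) (hc : l.IsChain G.Adj) : l.length < k := by
  by_cases hne : l = []
  · simpa [hne] using hk
  · obtain ⟨b, hb⟩ := SpanPath.exists_of_isChain l hl hc hne
    simpa [List.toFinset_card_of_nodup hl] using h _ _ _ hb

/-- From each vertex of `A` there starts a path inside `A` with at least `p` vertices. -/
def Traceable (G : SimpleGraph V) (A : Finset V) (p : ℕ) : Prop :=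
  ∀ a ∈ A, ∃ S ⊆ A, ∃ b, SpanPath G S a b ∧ p ≤ S.card

/-- The vertices of `U` cannot be split into two nonempty parts without an edge between them. -/
def Conn (G : SimpleGraph V) (U : Finset V) : Prop :=
  ∀ X ⊆ U, X.Nonempty → X ≠ U → ∃ x ∈ X, ∃ y ∈ U, y ∉ X ∧ G.Adj x y

variable {G : SimpleGraph V}

/-- Connectivity supplies an edge leaving `A`; its outer end can be put in front of a path inside
`A`. -/
theorem Traceable.lt_of_ssubset {A U : Finset V} {p k : ℕ} (hA : Traceable G A p)
    (hU : Conn G U) (hAU : A ⊆ U) (hne : A.Nonempty) (hlt : A ≠ U) (hf : PathFree G k) :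
    p + 1 < k := by
  obtain ⟨x, hx, y, -, hyA, hxy⟩ := hU A hAU hne hlt
  obtain ⟨S, hS, b, hp, hc⟩ := hA x hx
  have hy : y ∉ S := fun h => hyA (hS h)
  have := hf _ _ _ (SpanPath.cons hy hxy.symm hp)
  rw [card_insert_of_notMem hy] at this
  omega

/-- Grow `A` along edges that leave it. A new vertex starts a path through the old set, so
traceability survives. Once an edge reaches `B`, a path in the grown set and a path in `B` are
joined by it. -/
theorem Traceable.add_lt {A B U : Finset V} {p q k : ℕ} (hA : Traceable G A p)
    (hB : Traceable G B q) (hU : Conn G U) (hAU : A ⊆ U) (hBU : B ⊆ U) (hAne : A.Nonempty)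
    (hBne : B.Nonempty) (hd : Disjoint A B) (hf : PathFree G k) : p + q < k := by
  obtain ⟨n, hn⟩ : ∃ n, n = U.card - A.card := ⟨_, rfl⟩
  induction n using Nat.strong_induction_on generalizing A with
  | _ n ih =>
    have hAU' : A ≠ U := by
      rintro rfl
      exact hBne.ne_empty (Finset.disjoint_self_iff_empty _ |>.1 (hd.mono_left hBU))
    obtain ⟨x, hx, y, hyU, hyA, hxy⟩ := hU A hAU hAne hAU'
    obtain ⟨S, hS, b, hp, hc⟩ := hA x hx
    by_cases hyB : y ∈ B
    · obtain ⟨T, hT, c, hp', hc'⟩ := hB y hyB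
      have hST : Disjoint S T := (hd.mono_left hS).mono_right hT
      have := hf _ _ _ (hp.symm.append hp' hST hxy)
      rw [card_union_of_disjoint hST] at this
      omega
    · have hsub : insert y A ⊆ U := insert_subset hyU hAU
      have hle := card_le_card hsub
      rw [card_insert_of_notMem hyA] at hle
      refine ih (U.card - (insert y A).card) ?_ ?_ hsub (by simp) ?_ rfl
      · rw [card_insert_of_notMem hyA]
        omega
      · intro a ha
        rcases mem_insert.1 ha with rfl | ha
        · have hy : a ∉ S := fun h => hyA (hS h)
          refine ⟨insert a S, insert_subset_insert _ hS, b, .cons hy hxy.symm hp, ?_⟩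
          rw [card_insert_of_notMem hy]
          omega
        · obtain ⟨S, hS, b, hp, hc⟩ := hA a ha
          exact ⟨S, hS.trans (subset_insert _ _), b, hp, hc⟩
      · rw [disjoint_insert_left]
        exact ⟨hyB, hd⟩

/-- A closed path is traceable. -/
theorem SpanPath.traceable {S : Finset V} {a b : V} (h : SpanPath G S a b) (hab : G.Adj a b) :
    Traceable G S S.card := by
  intro c hc
  by_cases hcb : c = b
  · subst hcb
    exact ⟨S, Subset.rfl, a, h.symm, le_rfl⟩
  · obtain ⟨S₁, S₂, d, rfl, hd, h₁, h₂, -⟩ := h.split hc hcb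
    exact ⟨_, Subset.rfl, d, h₁.symm.append h₂.symm hd hab, le_rfl⟩

/-- A path whose ends have enough neighbours on it spans a traceable set. -/
theorem SpanPath.traceable_of_card {S : Finset V} {a b : V} [DecidableRel G.Adj]
    (h : SpanPath G S a b)
    (hcard : S.card ≤ #{v ∈ S | G.Adj a v} + #{v ∈ S | G.Adj b v}) :
    Traceable G S S.card := by
  -- With `c` adjacent to `b` and its successor `d` adjacent to `a`, the path from `c` back to `a`,
  -- then from `d` on to `b`, is closed by the edge between `b` and `c`.
  obtain ⟨S₁, S₂, c, d, rfl, hd, h₁, h₂, hcd, hc, hdd⟩ :=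
    h.crossing (filter_subset _ _) (filter_subset _ _) (by simp) (by simp) hcard
  simp only [mem_filter] at hc hdd
  exact (h₁.symm.append h₂ hd hdd.2).traceable hc.2.symm

end

/-! ### Degrees into a set and Dirac–Ore type theorems. -/

section

variable {V : Type*} [DecidableEq V] {G : SimpleGraph V}

/-- A longest path inside a nonempty set: neighbours of its first vertex lie on the path. -/
theorem exists_longest {X : Finset V} (hX : X.Nonempty) :
    ∃ S ⊆ X, ∃ a b, SpanPath G S a b ∧ (∀ v ∈ X, G.Adj a v → v ∈ S) ∧
      (∀ v ∈ X, G.Adj b v → v ∈ S) ∧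
      ∀ T ⊆ X, ∀ c d, SpanPath G T c d → T.card ≤ S.card := by
  classical
  obtain ⟨x, hx⟩ := hX
  obtain ⟨S, hS, hmax⟩ := exists_max_image
    (X.powerset.filter fun S => ∃ a b, SpanPath G S a b) card
    ⟨{x}, by simpa [hx] using ⟨x, x, SpanPath.single (G := G) x⟩⟩
  simp only [mem_filter, mem_powerset] at hS hmax
  obtain ⟨hSX, a, b, hp⟩ := hS
  have key : ∀ a b, SpanPath G S a b → ∀ v ∈ X, G.Adj a v → v ∈ S := by
    intro a b hp v hv hav
    by_contra hvS
    have := hmax _ ⟨insert_subset hv hSX, v, b, SpanPath.cons hvS hav.symm hp⟩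
    rw [card_insert_of_notMem hvS] at this
    omega
  exact ⟨S, hSX, a, b, hp, key a b hp, key b a hp.symm,
    fun T hT c d hcd => hmax T ⟨hT, c, d, hcd⟩⟩

variable [DecidableRel G.Adj]

/-- The number of neighbours of `v` in `U`. -/
def degIn (G : SimpleGraph V) [DecidableRel G.Adj] (U : Finset V) (v : V) : ℕ :=
  #{w ∈ U | G.Adj v w}

theorem degIn_mono {U W : Finset V} (h : U ⊆ W) (v : V) : degIn G U v ≤ degIn G W v :=
  card_le_card (filter_subset_filter _ h)

theorem degIn_union {U W : Finset V} (h : Disjoint U W) (v : V) :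
    degIn G (U ∪ W) v = degIn G U v + degIn G W v := by
  rw [degIn, filter_union, card_union_of_disjoint (disjoint_filter_filter h)]
  rfl

theorem degIn_insert {U : Finset V} {x : V} (h : x ∉ U) (v : V) :
    degIn G (insert x U) v = degIn G U v + if G.Adj v x then 1 else 0 := by
  rw [degIn, filter_insert]
  split_ifs
  · rw [card_insert_of_notMem (by simp [h])]
    rfl
  · rfl

theorem degIn_erase_add_one {U : Finset V} {x v : V} : degIn G U v ≤ degIn G (U.erase x) v + 1 := by
  by_cases hx : x ∈ U
  · conv_lhs => rw [← insert_erase hx]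
    rw [degIn_insert (by simp)]
    split_ifs <;> omega
  · rw [erase_eq_of_notMem hx]
    omega

theorem degIn_lt_card {U : Finset V} {v : V} (h : v ∈ U) : degIn G U v < U.card := by
  refine card_lt_card ⟨filter_subset _ _, fun hs => ?_⟩
  simpa using hs h

theorem degIn_le_card {U : Finset V} {v : V} : degIn G U v ≤ U.card :=
  card_filter_le _ _

theorem degIn_le_of_forall {U S : Finset V} {v : V} (h : ∀ w ∈ U, G.Adj v w → w ∈ S) :
    degIn G U v ≤ #{w ∈ S | G.Adj v w} := by
  refine card_le_card fun w hw => ?_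
  simp only [mem_filter] at hw ⊢
  exact ⟨h w hw.1 hw.2, hw.2⟩

theorem exists_adj_of_degIn_pos {U : Finset V} {v : V} (h : 0 < degIn G U v) :
    ∃ w ∈ U, G.Adj v w := by
  obtain ⟨w, hw⟩ := card_pos.1 h
  exact ⟨w, (mem_filter.1 hw).1, (mem_filter.1 hw).2⟩

theorem exists_adj_ne_of_two_le {U : Finset V} {v : V} (h : 2 ≤ degIn G U v) (x : V) :
    ∃ w ∈ U, w ≠ x ∧ G.Adj v w := by
  obtain ⟨w, hw, hne⟩ := exists_mem_ne h x
  exact ⟨w, (mem_filter.1 hw).1, hne, (mem_filter.1 hw).2⟩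

theorem exists_adj_ne_ne_of_three_le {U : Finset V} {v : V} (h : 3 ≤ degIn G U v) (x y : V) :
    ∃ w ∈ U, w ≠ x ∧ w ≠ y ∧ G.Adj v w := by
  have h2 : 2 ≤ degIn G (U.erase x) v := by
    have := degIn_erase_add_one (G := G) (U := U) (x := x) (v := v)
    omega
  obtain ⟨w, hw, hne, hvw⟩ := exists_adj_ne_of_two_le h2 y
  exact ⟨w, mem_of_mem_erase hw, ne_of_mem_erase hw, hne, hvw⟩

/-- A graph whose minimum degree is at least half of its order has a Hamiltonian path from each
vertex. -/
theorem traceable_of_minDegree {K : Finset V} {d : ℕ} (hd : ∀ v ∈ K, d ≤ degIn G K v)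
    (hK : K.card ≤ 2 * d) : Traceable G K K.card := by
  rcases K.eq_empty_or_nonempty with rfl | hne
  · intro a ha
    simp at ha
  obtain ⟨S, hSK, a, b, hp, ha, hb, hmax⟩ := exists_longest (G := G) hne
  have h1 := (hd a (hSK hp.left_mem)).trans (degIn_le_of_forall ha)
  have h2 := (hd b (hSK hp.right_mem)).trans (degIn_le_of_forall hb)
  have hle := card_le_card hSK
  have ht := hp.traceable_of_card (by omega)
  suffices S = K by rwa [this] at ht
  by_contra hSne
  obtain ⟨y, hyK, hyS⟩ := exists_of_ssubset (hSK.ssubset_of_ne hSne)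
  by_cases hy : ∃ x ∈ S, G.Adj x y
  · obtain ⟨x, hx, hxy⟩ := hy
    obtain ⟨T, hT, c, hpc, hc⟩ := ht x hx
    have hyT : y ∉ T := fun h => hyS (hT h)
    have := hmax _ (insert_subset hyK (hT.trans hSK)) _ _ (SpanPath.cons hyT hxy.symm hpc)
    rw [card_insert_of_notMem hyT] at this
    omega
  -- Without an edge between `y` and `S`, both `S` and its complement in `K` have more than `d`
  -- vertices, too many for `K`.
  · push Not at hy
    have h3 : degIn G K y ≤ degIn G (K \ S) y := by
      refine degIn_le_of_forall fun w hw hyw => ?_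
      rw [mem_sdiff]
      exact ⟨hw, fun hwS => hy w hwS hyw.symm⟩
    have h4 := degIn_lt_card (G := G) (U := K \ S) (v := y) (by simp [hyK, hyS])
    have h5 := degIn_lt_card (G := G) hp.left_mem
    have h6 := hd y hyK
    rw [card_sdiff_of_subset hSK] at h4
    rw [degIn] at h5
    omega

/-- Ore's condition for Hamilton-connectedness. -/
theorem spanPath_of_minDegree {S : Finset V} {d : ℕ} (hd : ∀ v ∈ S, d ≤ degIn G S v)
    (hS : S.card + 1 ≤ 2 * d) {u v : V} (hu : u ∈ S) (hv : v ∈ S) (huv : u ≠ v) :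
    SpanPath G S u v := by
  have hcard : (S.erase u).card = S.card - 1 := card_erase_of_mem hu
  have hpos : 0 < S.card := card_pos.2 ⟨u, hu⟩
  have hvu : v ∈ S.erase u := mem_erase.2 ⟨huv.symm, hv⟩
  have ht : Traceable G (S.erase u) (S.erase u).card := by
    refine traceable_of_minDegree (d := d - 1) (fun w hw => ?_) (by omega)
    have := hd w (mem_of_mem_erase hw)
    have := degIn_erase_add_one (G := G) (U := S) (x := u) (v := w)
    omega
  obtain ⟨T, hT, x, hp, hc⟩ := ht v hvu
  obtain rfl : T = S.erase u := eq_of_subset_of_card_le hT hc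
  have hx := hp.right_mem
  have hxd : d - 1 ≤ degIn G (S.erase u) x := by
    have := hd x (mem_of_mem_erase hx)
    have := degIn_erase_add_one (G := G) (U := S) (x := u) (v := x)
    omega
  have hud : d - 1 ≤ #({w ∈ S.erase u | G.Adj u w}.erase v) := by
    have h1 := hd u hu
    have h2 : degIn G S u = degIn G (S.erase u) u := by
      conv_lhs => rw [← insert_erase hu]
      rw [degIn_insert (by simp)]
      simp
    have h3 := pred_card_le_card_erase (s := {w ∈ S.erase u | G.Adj u w}) (a := v)
    simp only [degIn] at h1 h2
    omega
  -- The path from `v` to `x` covers everything but `u`. If `c` is adjacent to `x` and its successor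
  -- `e` to `u`, the route from `v` to `c`, to `x`, back to `e` and on to `u` covers `S`.
  obtain ⟨S₁, S₂, c, e, hU, hdj, h₁, h₂, hce, hcB, heA⟩ :=
    hp.crossing (A := {w ∈ S.erase u | G.Adj u w}.erase v)
      (B := {w ∈ S.erase u | G.Adj x w}) ((erase_subset _ _).trans (filter_subset _ _))
      (filter_subset _ _) (by simp) (by simp) (by
        rw [degIn] at hxd
        omega)
  simp only [mem_filter, mem_erase] at hcB heA
  have h3 := h₁.append h₂.symm hdj hcB.2.symm
  rw [← hU] at h3
  simpa [insert_erase hu] using SpanPath.cons (by simp) heA.2.2 h3.symm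

end

/-! ### Degree sums, degeneracy and cores. -/

section

variable {V : Type*} [DecidableEq V] {G : SimpleGraph V} [DecidableRel G.Adj]

/-- The sum of the degrees in the subgraph induced on `U`. -/
def degSum (G : SimpleGraph V) [DecidableRel G.Adj] (U : Finset V) : ℕ :=
  ∑ v ∈ U, degIn G U v

theorem degSum_insert {U : Finset V} {x : V} (hx : x ∉ U) :
    degSum G (insert x U) = degSum G U + 2 * degIn G U x := by
  have h1 : ∑ v ∈ U, degIn G (insert x U) v = degSum G U + degIn G U x := by
    rw [sum_congr rfl fun v _ => degIn_insert hx v, sum_add_distrib, ← card_filter]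
    simp only [degSum, degIn, G.adj_comm]
  rw [degSum, sum_insert hx, h1, degIn_insert hx]
  simp only [SimpleGraph.irrefl, if_false]
  ring

theorem degSum_erase {U : Finset V} {x : V} (hx : x ∈ U) :
    degSum G U = degSum G (U.erase x) + 2 * degIn G U x := by
  conv_lhs => rw [← insert_erase hx]
  have : degIn G U x = degIn G (U.erase x) x := by
    conv_lhs => rw [← insert_erase hx]
    rw [degIn_insert (by simp)]
    simp
  rw [degSum_insert (by simp), this]

theorem even_degSum (U : Finset V) : Even (degSum G U) := by
  induction U using Finset.induction_on with
  | empty => simp [degSum]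
  | insert x U hx ih =>
    rw [degSum_insert hx]
    exact ih.add (even_two_mul _)

theorem degSum_le (U : Finset V) : degSum G U ≤ U.card * (U.card - 1) := by
  rw [← smul_eq_mul]
  refine sum_le_card_nsmul _ _ _ fun v hv => ?_
  have := degIn_lt_card (G := G) hv
  omega

/-- Removing vertices of degree at most `t` one by one from `U` until `K` is left. -/
theorem degSum_le_of_degenerate {K U : Finset V} {t : ℕ} (hKU : K ⊆ U)
    (h : ∀ X ⊆ U, K ⊂ X → ∃ v ∈ X, v ∉ K ∧ degIn G X v ≤ t) :
    degSum G U + 2 * t * K.card ≤ degSum G K + 2 * t * U.card := by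
  induction U using Finset.strongInduction with
  | _ U ih =>
    by_cases hne : K = U
    · rw [hne]
    · obtain ⟨v, hv, hvK, hd⟩ := h U Subset.rfl (hKU.ssubset_of_ne hne)
      have h1 := ih (U.erase v) (erase_ssubset hv) (subset_erase.2 ⟨hKU, hvK⟩)
        fun X hX => h X (hX.trans (erase_subset _ _))
      rw [degSum_erase hv, ← card_erase_add_one hv]
      nlinarith

/-- Each removal costs at most `2 * t`, and the last `t` vertices contribute at most `t * (t - 1)`.
-/
theorem degSum_le_of_forall_exists {U : Finset V} {t : ℕ} (ht : t ≤ U.card)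
    (h : ∀ X ⊆ U, X.Nonempty → ∃ v ∈ X, degIn G X v ≤ t) :
    degSum G U + t * (t + 1) ≤ 2 * t * U.card := by
  induction U using Finset.strongInduction with
  | _ U ih =>
    rcases ht.eq_or_lt with heq | hlt
    · have := degSum_le (G := G) U
      rw [← heq] at this ⊢
      rcases t with _ | t
      · simpa using this
      · simp only [Nat.add_sub_cancel] at this
        nlinarith
    · obtain ⟨v, hv, hd⟩ := h U Subset.rfl (card_pos.1 (by omega))
      have hc := card_erase_add_one hv
      have h1 := ih (U.erase v) (erase_ssubset hv) (by omega)
        (fun X hX => h X (hX.trans (erase_subset _ _)))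
      rw [degSum_erase hv, ← hc]
      nlinarith

/-- Among the subsets of `U` inducing minimum degree at least `m` there is a largest one. -/
theorem exists_core (G : SimpleGraph V) [DecidableRel G.Adj] (U : Finset V) (m : ℕ) :
    ∃ K ⊆ U, (∀ v ∈ K, m ≤ degIn G K v) ∧
      ∀ X ⊆ U, K ⊂ X → ∃ v ∈ X, v ∉ K ∧ degIn G X v < m := by
  obtain ⟨K, hK, hmax⟩ := exists_max_image
    (U.powerset.filter fun K => ∀ v ∈ K, m ≤ degIn G K v) card ⟨∅, by simp⟩
  simp only [mem_filter, mem_powerset] at hK hmax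
  refine ⟨K, hK.1, hK.2, fun X hX hKX => ?_⟩
  by_contra! hcon
  refine absurd (hmax X ⟨hX, fun v hv => ?_⟩) (not_le.2 (card_lt_card hKX))
  by_cases hvK : v ∈ K
  · exact (hK.2 v hvK).trans (degIn_mono hKX.subset v)
  · exact hcon v hv hvK

/-- A longest path in `K` has at most `2 * m` vertices, while each end has at least `m` neighbours
on it. So its vertices lie on a cycle, and an edge of `K` leaving them would give a longer path. -/
theorem exists_block {K : Finset V} {m : ℕ} (hne : K.Nonempty)
    (hd : ∀ v ∈ K, m ≤ degIn G K v) (hf : PathFree G (2 * m + 1)) :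
    ∃ S ⊆ K, S.Nonempty ∧ Traceable G S S.card ∧ m + 1 ≤ S.card ∧
      ∀ x ∈ S, ∀ y ∈ K, G.Adj x y → y ∈ S := by
  obtain ⟨S, hSK, a, b, hp, ha, hb, hmax⟩ := exists_longest (G := G) hne
  have h1 := (hd a (hSK hp.left_mem)).trans (degIn_le_of_forall ha)
  have h2 := (hd b (hSK hp.right_mem)).trans (degIn_le_of_forall hb)
  have h3 := hf _ _ _ hp
  have ht := hp.traceable_of_card (by omega)
  refine ⟨S, hSK, ⟨a, hp.left_mem⟩, ht, h1.trans_lt (degIn_lt_card hp.left_mem), ?_⟩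
  intro x hx y hy hxy
  by_contra hyS
  obtain ⟨T, hT, c, hpc, hc⟩ := ht x hx
  have hyT : y ∉ T := fun h => hyS (hT h)
  have := hmax _ (insert_subset hy (hT.trans hSK)) _ _ (SpanPath.cons hyT hxy.symm hpc)
  rw [card_insert_of_notMem hyT] at this
  omega

/-- In a connected graph without a path on `2 * m + 1` vertices, a subgraph of minimum degree at
least `m` is small. -/
theorem card_core {U K : Finset V} {m : ℕ} (hU : Conn G U) (hcard : 2 * m + 1 ≤ U.card)
    (hf : PathFree G (2 * m + 1)) (hKU : K ⊆ U) (hne : K.Nonempty)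
    (hd : ∀ v ∈ K, m ≤ degIn G K v) : m + 1 ≤ K.card ∧ K.card + 1 ≤ 2 * m := by
  obtain ⟨S, hSK, hSne, hSt, hSc, hS⟩ := exists_block hne hd hf
  obtain rfl : S = K := by
    by_contra hSne'
    have hne' : (K \ S).Nonempty := sdiff_nonempty.2 fun h => hSne' (hSK.antisymm h)
    have hd' : ∀ v ∈ K \ S, m ≤ degIn G (K \ S) v := fun v hv => by
      rw [mem_sdiff] at hv
      refine (hd v hv.1).trans (degIn_le_of_forall fun w hw hvw => ?_)
      rw [mem_sdiff]
      exact ⟨hw, fun hwS => hv.2 (hS w hwS v hv.1 hvw.symm)⟩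
    -- Two disjoint blocks of at least `m + 1` vertices each would be linked through `U` into a path
    -- that is too long.
    obtain ⟨T, hTK, hTne, hTt, hTc, -⟩ := exists_block hne' hd' hf
    have := hSt.add_lt hTt hU (hSK.trans hKU) (hTK.trans (sdiff_subset.trans hKU)) hSne hTne
      (disjoint_sdiff.mono_right hTK) hf
    omega
  have hSU : S ≠ U := by
    rintro rfl
    obtain ⟨a, ha⟩ := hSne
    obtain ⟨T, hT, b, hp, hc⟩ := hSt a ha
    have := hf _ _ _ hp
    omega
  have := hSt.lt_of_ssubset hU hKU hSne hSU hf
  omega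

end

/-! ### Edge bounds for connected graphs without a path on seven or nine vertices. -/

section

variable {V : Type*} [DecidableEq V] {G : SimpleGraph V} [DecidableRel G.Adj]

/-- Cut the path at the last neighbour of `a`: the initial segment is closed by an edge and contains
`a` with all its neighbours on the path. -/
theorem SpanPath.exists_traceable {S : Finset V} {a b : V} (h : SpanPath G S a b) {r : ℕ}
    (hr : 1 ≤ r) (hcard : r ≤ #{v ∈ S | G.Adj a v}) :
    ∃ T ⊆ S, T.Nonempty ∧ Traceable G T (r + 1) := by
  obtain ⟨w, hw, T, hTS, hp, hN⟩ := h.exists_prefix (N := {v ∈ S | G.Adj a v})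
    (filter_subset _ _) (card_pos.1 (by omega))
  have hc : r + 1 ≤ T.card := by
    have h1 : insert a {v ∈ S | G.Adj a v} ⊆ T := insert_subset hp.left_mem hN
    have h2 := card_le_card h1
    rw [card_insert_of_notMem (by simp)] at h2
    omega
  refine ⟨T, hTS, ⟨a, hp.left_mem⟩, fun c hcT => ?_⟩
  obtain ⟨S', hS', d, hd, hd'⟩ := hp.traceable (mem_filter.1 hw).2 c hcT
  exact ⟨S', hS', d, hd, hc.trans hd'⟩

theorem SpanPath.card_add_lt {S K : Finset V} {a b p : V} {q k : ℕ} (h : SpanPath G S a b)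
    (hK : Traceable G K q) (hp : p ∈ K) (hap : G.Adj a p) (hd : Disjoint S K)
    (hf : PathFree G k) : S.card + q < k := by
  obtain ⟨T, hT, c, hc, hq⟩ := hK p hp
  have hST := hd.mono_right hT
  have := hf _ _ _ (h.symm.append hc hST hap)
  rw [card_union_of_disjoint hST] at this
  omega

theorem SpanPath.traceable_union {S K : Finset V} {a b p q : V} (h : SpanPath G S a b)
    (hK : SpanPath G K p q) (hap : G.Adj a p) (hbq : G.Adj b q) (hd : Disjoint S K) :
    Traceable G (S ∪ K) (S.card + K.card) := by
  rw [← card_union_of_disjoint hd]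
  exact (h.append hK.symm hd hbq).traceable hap

theorem degIn_le_add {X K S : Finset V} {a : V} (hKX : K ⊆ X)
    (h : ∀ v ∈ X \ K, G.Adj a v → v ∈ S) :
    degIn G X a ≤ degIn G K a + #{v ∈ S | G.Adj a v} := by
  conv_lhs => rw [← union_sdiff_of_subset hKX]
  rw [degIn_union disjoint_sdiff]
  exact Nat.add_le_add_left (degIn_le_of_forall h) _

/-- The first vertex of a longest path outside a dense block `K` is attached to `K`. -/
theorem SpanPath.attached {U X K S : Finset V} {a b : V} {k q r : ℕ} (h : SpanPath G S a b)
    (hU : Conn G U) (hf : PathFree G k) (hXU : X ⊆ U) (hKX : K ⊆ X) (hS : S ⊆ X \ K)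
    (hKne : K.Nonempty) (hK : Traceable G K q) (hr : 1 ≤ r) (hk : k ≤ r + 1 + q)
    (ha : ∀ v ∈ X \ K, G.Adj a v → v ∈ S) (hd : r ≤ degIn G X a) :
    0 < degIn G K a ∧ S.card + q < k := by
  have hSK : Disjoint S K := disjoint_sdiff_self_left.mono_left hS
  have h1 := degIn_le_add hKX ha
  -- Otherwise all `r` neighbours of `a` lie on the path, giving a traceable set disjoint from `K`
  -- whose bound `r + 1` adds with `q` to at least `k`.
  have h2 : 0 < degIn G K a := by
    by_contra h0
    obtain ⟨T, hTS, hTne, hT⟩ := h.exists_traceable (r := r) hr (by omega)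
    have := hT.add_lt hK hU (hTS.trans (hS.trans (sdiff_subset.trans hXU))) (hKX.trans hXU) hTne
      hKne (hSK.mono_left hTS) hf
    omega
  obtain ⟨p, hp, hap⟩ := exists_adj_of_degIn_pos h2
  exact ⟨h2, h.card_add_lt hK hp hap hSK hf⟩

theorem SpanPath.card_filter_lt {S : Finset V} {a b : V} (h : SpanPath G S a b) :
    #{v ∈ S | G.Adj a v} < S.card :=
  degIn_lt_card h.left_mem

/-- The bound for graphs with a core on `2 * m - 1` vertices. -/
theorem degSum_le_of_large_core {U K : Finset V} {m : ℕ} (hU : Conn G U)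
    (hcard : 2 * m + 1 ≤ U.card) (hf : PathFree G (2 * m + 1)) (hKU : K ⊆ U)
    (hd : ∀ v ∈ K, m ≤ degIn G K v) (hne : K.Nonempty) (hK : K.card + 1 = 2 * m) :
    degSum G U + 2 * K.card ≤ degSum G K + 2 * U.card := by
  have hKt : Traceable G K K.card := traceable_of_minDegree hd (by omega)
  -- If all vertices of `X` outside `K` had degree at least two, a longest path there would be a
  -- single vertex with two neighbours in `K`. It closes to a cycle on `2 * m` vertices, from which
  -- an edge leaves.
  refine degSum_le_of_degenerate (t := 1) hKU fun X hXU hKX => ?_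
  by_contra! hcon
  obtain ⟨S, hS, a, b, hp, ha, -, -⟩ :=
    exists_longest (G := G) (X := X \ K) (sdiff_nonempty.2 hKX.not_subset)
  have haX := mem_sdiff.1 (hS hp.left_mem)
  have had : 2 ≤ degIn G X a := hcon a haX.1 haX.2
  obtain ⟨-, h1⟩ := hp.attached hU hf hXU hKX.subset hS hne hKt (by omega) (by omega) ha had
  have h2 := degIn_le_add hKX.subset ha
  have h3 := hp.card_filter_lt
  obtain ⟨p, hp', hap⟩ := exists_adj_of_degIn_pos (G := G) (U := K) (v := a) (by omega)
  obtain ⟨q, hq, hqp, haq⟩ := exists_adj_ne_of_two_le (G := G) (U := K) (v := a) (by omega) p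
  have hdis : Disjoint {a} K := by simpa using haX.2
  have ht := (SpanPath.single a).traceable_union
    (spanPath_of_minDegree hd (by omega) hp' hq hqp.symm) hap haq hdis
  rw [card_singleton] at ht
  have := ht.lt_of_ssubset hU (union_subset (by simpa using hXU haX.1) hKU)
    ⟨a, by simp⟩ (fun h => by
      have := congrArg card h
      rw [card_union_of_disjoint hdis, card_singleton] at this
      omega) hf
  omega

/-- A path ending at `x` is prolonged through `p`, `y`, the rest of `K`, and `z`. -/
theorem card_add_lt_of_insertion {K S : Finset V} {m k : ℕ} {s x y z p : V}
    (hd : ∀ v ∈ K, m ≤ degIn G K v) (hK : K.card + 2 ≤ 2 * m) (hf : PathFree G k)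
    (h : SpanPath G S s x) (hSK : Disjoint S K) (hyS : y ∉ S) (hzS : z ∉ S) (hyK : y ∉ K)
    (hzK : z ∉ K) (hyz : y ≠ z) (hp : p ∈ K) (hxp : G.Adj x p) (hyp : G.Adj y p)
    (hy : 3 ≤ degIn G K y) (hz : 2 ≤ degIn G K z) : S.card + K.card + 2 < k := by
  obtain ⟨d, hdK, hdp, hzd⟩ := exists_adj_ne_of_two_le hz p
  obtain ⟨b, hbK, hbp, hbd, hyb⟩ := exists_adj_ne_ne_of_three_le hy p d
  -- Deleting `p` lowers size and minimum degree by one each, hence the condition `K.card + 2 ≤ 2 *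
  -- m`.
  have hpath : SpanPath G (K.erase p) b d := by
    refine spanPath_of_minDegree (d := m - 1) (fun v hv => ?_) ?_ (mem_erase.2 ⟨hbp, hbK⟩)
      (mem_erase.2 ⟨hdp, hdK⟩) hbd
    · have := hd v (mem_of_mem_erase hv)
      have := degIn_erase_add_one (G := G) (U := K) (x := p) (v := v)
      omega
    · rw [card_erase_of_mem hp]
      have := card_pos.2 ⟨p, hp⟩
      omega
  have hpS : p ∉ S := fun h => disjoint_left.1 hSK h hp
  have hpy : y ≠ p := fun h => hyK (h ▸ hp)
  have hpz : z ≠ p := fun h => hzK (h ▸ hp)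
  have h1 := (h.snoc hpS hxp).snoc (c := y) (by simp [hpy, hyS]) hyp.symm
  have hdis : Disjoint (insert y (insert p S)) (K.erase p) := by
    rw [disjoint_insert_left, disjoint_insert_left]
    exact ⟨fun h => hyK (mem_of_mem_erase h), by simp, hSK.mono_right (erase_subset _ _)⟩
  have h2 := (h1.append hpath hdis hyb).snoc (c := z)
    (by simp [hyz.symm, hzS, hzK, hpz]) hzd.symm
  have h3 := hf _ _ _ h2
  rw [card_insert_of_notMem (by simp [hyz.symm, hzS, hzK, hpz]),
    card_union_of_disjoint hdis, card_insert_of_notMem (by simp [hpy, hyS]),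
    card_insert_of_notMem hpS, card_erase_of_mem hp] at h3
  have := card_pos.2 ⟨p, hp⟩
  omega

theorem exists_common_of_card_lt {K : Finset V} {x y : V}
    (h : K.card < degIn G K x + degIn G K y) : ∃ p ∈ K, G.Adj x p ∧ G.Adj y p := by
  by_contra! hcon
  have hdis : Disjoint {v ∈ K | G.Adj x v} {v ∈ K | G.Adj y v} :=
    disjoint_filter.2 fun v hv => hcon v hv
  have := card_le_card (union_subset (filter_subset (fun v => G.Adj x v) K)
    (filter_subset (fun v => G.Adj y v) K))
  rw [card_union_of_disjoint hdis] at this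
  simp only [degIn] at h
  omega

theorem exists_common_of_three {K : Finset V} {x y z : V}
    (h : K.card < degIn G K x + degIn G K y + degIn G K z) :
    ∃ p ∈ K, (G.Adj x p ∧ G.Adj y p) ∨ (G.Adj x p ∧ G.Adj z p) ∨ (G.Adj y p ∧ G.Adj z p) := by
  by_contra! hcon
  have hdis : Disjoint {v ∈ K | G.Adj x v} {v ∈ K | G.Adj y v} :=
    disjoint_filter.2 fun v hv => (hcon v hv).1
  have hdis' : Disjoint ({v ∈ K | G.Adj x v} ∪ {v ∈ K | G.Adj y v}) {v ∈ K | G.Adj z v} := by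
    rw [disjoint_union_left]
    exact ⟨disjoint_filter.2 fun v hv => (hcon v hv).2.1,
      disjoint_filter.2 fun v hv => (hcon v hv).2.2⟩
  have := card_le_card (union_subset (union_subset (filter_subset (fun v => G.Adj x v) K)
    (filter_subset (fun v => G.Adj y v) K)) (filter_subset (fun v => G.Adj z v) K))
  rw [card_union_of_disjoint hdis', card_union_of_disjoint hdis] at this
  simp only [degIn] at h
  omega

/-- The bound for graphs without a path on nine vertices that have a core on six vertices. -/
theorem degSum_le_of_core_six {U K : Finset V} (hU : Conn G U)
    (hcard : 9 ≤ U.card) (hf : PathFree G 9) (hKU : K ⊆ U)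
    (hd : ∀ v ∈ K, 4 ≤ degIn G K v) (hK : K.card = 6)
    (hmax : ∀ X ⊆ U, K ⊂ X → ∃ v ∈ X, v ∉ K ∧ degIn G X v < 4) :
    degSum G U ≤ 4 * U.card + 10 := by
  have hKne : K.Nonempty := card_pos.1 (by omega)
  have hKt : Traceable G K K.card := traceable_of_minDegree hd (by omega)
  -- Three vertices of `F` send nine edges into the six vertices of `K`, so two of them share a
  -- neighbour and `card_add_lt_of_insertion` gives nine vertices on a path. Hence only two vertices
  -- need peeling at degree three, the others at degree two: `30 + 6 * 2 + 4 * (U.card - 8) = 4 *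
  -- U.card + 10`.
  set F := {t ∈ U \ K | 3 ≤ degIn G K t} with hF
  have hFU : K ∪ F ⊆ U := union_subset hKU ((filter_subset _ _).trans sdiff_subset)
  have hFK : Disjoint K F := disjoint_sdiff.mono_right (filter_subset _ _)
  have hF2 : F.card ≤ 2 := by
    by_contra! h2
    obtain ⟨x, hx, y, hy, z, hz, hxy, hxz, hyz⟩ := two_lt_card.1 h2
    simp only [hF, mem_filter, mem_sdiff] at hx hy hz
    have key : ∀ x y z p, x ∉ K → y ∉ K → z ∉ K → 3 ≤ degIn G K y → 3 ≤ degIn G K z →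
        x ≠ y → x ≠ z → y ≠ z → p ∈ K → G.Adj x p → G.Adj y p → False := by
      intro x y z p hxK hyK hzK hy hz hxy hxz hyz hp hxp hyp
      have := card_add_lt_of_insertion hd (by omega) hf (SpanPath.single x) (by simpa using hxK)
        (by simpa using hxy.symm) (by simpa using hxz.symm) hyK hzK hyz hp hxp hyp hy (by omega)
      rw [card_singleton] at this
      omega
    obtain ⟨p, hp, h | h | h⟩ := exists_common_of_three (G := G) (K := K) (x := x) (y := y)
      (z := z) (by omega)
    · exact key x y z p hx.1.2 hy.1.2 hz.1.2 hy.2 hz.2 hxy hxz hyz hp h.1 h.2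
    · exact key x z y p hx.1.2 hz.1.2 hy.1.2 hz.2 hy.2 hxz hxy hyz.symm hp h.1 h.2
    · exact key y z x p hy.1.2 hz.1.2 hx.1.2 hz.2 hx.2 hyz hxy.symm hxz.symm hp h.1 h.2
  have h1 : degSum G (K ∪ F) + 2 * 3 * K.card ≤ degSum G K + 2 * 3 * (K ∪ F).card := by
    refine degSum_le_of_degenerate subset_union_left fun X hX hKX => ?_
    obtain ⟨v, hv, hvK, hlt⟩ := hmax X (hX.trans hFU) hKX
    exact ⟨v, hv, hvK, by omega⟩
  -- If peeling stops, a longest path outside `K` has at most two vertices. A single vertex forces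
  -- membership in `F`; an edge closes through `K` to a cycle on eight vertices, from which an edge
  -- leaves.
  have h2 : degSum G U + 2 * 2 * (K ∪ F).card ≤ degSum G (K ∪ F) + 2 * 2 * U.card := by
    refine degSum_le_of_degenerate hFU fun X hXU hKX => ?_
    by_contra! hcon
    have hKX' : K ⊆ X := subset_union_left.trans hKX.subset
    have hdeg : ∀ v ∈ X \ K, 3 ≤ degIn G X v := fun v hv => by
      rw [mem_sdiff] at hv
      by_cases hvF : v ∈ F
      · exact (mem_filter.1 hvF).2.trans (degIn_mono hKX' v)
      · exact hcon v hv.1 (by simp [hv.2, hvF])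
    obtain ⟨v, hvX, hvKF⟩ := exists_of_ssubset hKX
    have hvK : v ∉ K := fun h => hvKF (mem_union_left _ h)
    have hvF : v ∉ F := fun h => hvKF (mem_union_right _ h)
    have hvXK : v ∈ X \ K := mem_sdiff.2 ⟨hvX, hvK⟩
    obtain ⟨S, hS, a, b, hp, ha, hb, hlong⟩ := exists_longest (G := G) (X := X \ K) ⟨v, hvXK⟩
    have hSK : Disjoint S K := disjoint_sdiff_self_left.mono_left hS
    obtain ⟨-, hSc⟩ := hp.attached hU hf hXU hKX' hS hKne hKt (r := 3) (by omega) (by omega) ha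
      (hdeg a (hS hp.left_mem))
    have hSpos : 0 < S.card := card_pos.2 ⟨a, hp.left_mem⟩
    obtain hS1 | hS2 : S.card = 1 ∨ S.card = 2 := by omega
    · have h0 : degIn G X v ≤ degIn G K v + #{w ∈ (∅ : Finset V) | G.Adj v w} := by
        refine degIn_le_add hKX' fun w hw hvw => ?_
        have := hlong {v, w} (by
          intro u hu
          rcases mem_insert.1 hu with rfl | hu
          · exact hvXK
          · rwa [mem_singleton.1 hu]) _ _ (SpanPath.cons (by simpa using hvw.ne) hvw (.single w))
        rw [card_pair hvw.ne] at this
        omega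
      have := hdeg v hvXK
      refine hvF (mem_filter.2 ⟨mem_sdiff.2 ⟨hXU hvX, hvK⟩, ?_⟩)
      simpa using this.trans h0
    · have ha1 := degIn_le_add hKX' ha
      have hb1 := degIn_le_add hKX' hb
      have ha2 := hp.card_filter_lt
      have hb2 := hp.symm.card_filter_lt
      have ha3 := hdeg a (hS hp.left_mem)
      have hb3 := hdeg b (hS hp.right_mem)
      obtain ⟨p, hp', hap⟩ := exists_adj_of_degIn_pos (G := G) (U := K) (v := a) (by omega)
      obtain ⟨q, hq, hqp, hbq⟩ :=
        exists_adj_ne_of_two_le (G := G) (U := K) (v := b) (by omega) p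
      have ht := hp.traceable_union (spanPath_of_minDegree hd (by omega) hp' hq hqp.symm)
        hap hbq hSK
      have := ht.lt_of_ssubset hU (union_subset (hS.trans (sdiff_subset.trans hXU)) hKU)
        ⟨a, mem_union_left _ hp.left_mem⟩ (fun h => by
          have := congrArg card h
          rw [card_union_of_disjoint hSK] at this
          omega) hf
      omega
  rw [card_union_of_disjoint hFK] at h1 h2
  have h3 := degSum_le (G := G) K
  rw [hK] at h1 h2 h3
  omega

theorem degSum_le_of_pathFree_seven {U : Finset V} (hU : Conn G U) (hcard : 7 ≤ U.card)
    (hf : PathFree G 7) : degSum G U + 2 ≤ 4 * U.card := by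
  obtain ⟨K, hKU, hd, hmax⟩ := exists_core G U 3
  rcases K.eq_empty_or_nonempty with rfl | hne
  · have := degSum_le_of_forall_exists (G := G) (U := U) (t := 2) (by omega) fun X hX hXne => by
      obtain ⟨v, hv, -, hlt⟩ := hmax X hX (empty_ssubset.2 hXne)
      exact ⟨v, hv, by omega⟩
    omega
  obtain ⟨h1, h2⟩ := card_core (m := 3) hU hcard hf hKU hne hd
  have h3 := degSum_le (G := G) K
  obtain hK | hK : K.card = 4 ∨ K.card = 5 := by omega
  · have := degSum_le_of_degenerate (G := G) (t := 2) hKU fun X hX hKX => by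
      obtain ⟨v, hv, hvK, hlt⟩ := hmax X hX hKX
      exact ⟨v, hv, hvK, by omega⟩
    rw [hK] at h3 this
    omega
  · have := degSum_le_of_large_core (m := 3) hU hcard hf hKU hd hne (by omega)
    rw [hK] at h3 this
    omega

/-- The cases are those of the size of the 4-core: empty, six or seven, five. A core of five is
returned as structure because on 17 vertices it only yields a degree sum of at most 92, whereas at
most 90 is needed. -/
theorem degSum_le_or_core_of_pathFree_nine {U : Finset V} (hU : Conn G U) (hcard : 9 ≤ U.card)
    (hf : PathFree G 9) : degSum G U + 12 ≤ 6 * U.card ∨ degSum G U ≤ 4 * U.card + 10 ∨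
      ∃ K ⊆ U, K.card = 5 ∧ (∀ v ∈ K, 4 ≤ degIn G K v) ∧
        ∀ X ⊆ U, K ⊂ X → ∃ v ∈ X, v ∉ K ∧ degIn G X v < 4 := by
  obtain ⟨K, hKU, hd, hmax⟩ := exists_core G U 4
  rcases K.eq_empty_or_nonempty with rfl | hne
  · left
    exact degSum_le_of_forall_exists (G := G) (U := U) (t := 3) (by omega) fun X hX hXne => by
      obtain ⟨v, hv, -, hlt⟩ := hmax X hX (empty_ssubset.2 hXne)
      exact ⟨v, hv, by omega⟩
  right
  obtain ⟨h1, h2⟩ := card_core (m := 4) hU hcard hf hKU hne hd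
  have h3 := degSum_le (G := G) K
  obtain hK | hK | hK : K.card = 5 ∨ K.card = 6 ∨ K.card = 7 := by omega
  · exact Or.inr ⟨K, hKU, hK, hd, hmax⟩
  · exact Or.inl (degSum_le_of_core_six hU hcard hf hKU hd hK hmax)
  · have := degSum_le_of_large_core (m := 4) hU hcard hf hKU hd hne (by omega)
    rw [hK] at h3 this
    omega

/-- The constant 8 is dictated by `4 * U.card + 10` at `U.card = 9`. -/
theorem degSum_le_of_pathFree_nine {U : Finset V} (hU : Conn G U) (hcard : 9 ≤ U.card)
    (hf : PathFree G 9) : degSum G U + 8 ≤ 6 * U.card := by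
  obtain h | h | ⟨K, hKU, hK, hd, hmax⟩ := degSum_le_or_core_of_pathFree_nine hU hcard hf
  · omega
  · omega
  · have h3 := degSum_le (G := G) K
    have := degSum_le_of_degenerate (G := G) (t := 3) hKU fun X hX hKX => by
      obtain ⟨v, hv, hvK, hlt⟩ := hmax X hX hKX
      exact ⟨v, hv, hvK, by omega⟩
    rw [hK] at h3 this
    omega

end

/-! ### The near-extremal connected graphs on 17 vertices. -/

section

variable {V : Type*} [DecidableEq V] {G : SimpleGraph V} [DecidableRel G.Adj]

theorem SpanPath.eq_singleton {S : Finset V} {a : V} (h : SpanPath G S a a) : S = {a} := by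
  cases h with
  | single => rfl
  | cons ha _ h => exact absurd h.right_mem ha

theorem two_le_degIn {U : Finset V} {v x y : V} (hx : x ∈ U) (hy : y ∈ U) (hxy : x ≠ y)
    (hvx : G.Adj v x) (hvy : G.Adj v y) : 2 ≤ degIn G U v :=
  one_lt_card.2 ⟨x, mem_filter.2 ⟨hx, hvx⟩, y, mem_filter.2 ⟨hy, hvy⟩, hxy⟩

/-- Two disjoint paths attached to different vertices of a dense block are joined through it. -/
theorem card_add_add_lt {K S T : Finset V} {m k : ℕ} {s x y t p q : V}
    (hd : ∀ v ∈ K, m ≤ degIn G K v) (hK : K.card + 1 ≤ 2 * m) (hf : PathFree G k)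
    (hS : SpanPath G S s x) (hT : SpanPath G T y t) (hSK : Disjoint S K) (hTK : Disjoint T K)
    (hST : Disjoint S T) (hp : p ∈ K) (hq : q ∈ K) (hpq : p ≠ q) (hxp : G.Adj x p)
    (hyq : G.Adj y q) : S.card + K.card + T.card < k := by
  have h1 := hS.append (spanPath_of_minDegree hd hK hp hq hpq) hSK hxp
  have hdis : Disjoint (S ∪ K) T := disjoint_union_left.2 ⟨hST, hTK.symm⟩
  have := hf _ _ _ (h1.append hT hdis hyq.symm)
  rwa [card_union_of_disjoint hdis, card_union_of_disjoint hSK] at this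

theorem SpanPath.pair {x y : V} (h : G.Adj x y) : SpanPath G {x, y} x y :=
  .cons (by simpa using h.ne) h (.single y)

theorem SpanPath.triple {x y z : V} (hxy : G.Adj x y) (hyz : G.Adj y z) (hxz : x ≠ z) :
    SpanPath G {x, y, z} x z :=
  .cons (by simp [hxy.ne, hxz]) hxy (.pair hyz)

theorem card_triple_le {X : Finset V} {k : ℕ}
    (h : ∀ T ⊆ X, ∀ c d, SpanPath G T c d → T.card ≤ k) {x y z : V} (hx : x ∈ X) (hy : y ∈ X)
    (hz : z ∈ X) (hxy : G.Adj x y) (hyz : G.Adj y z) (hxz : x ≠ z) : 3 ≤ k := by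
  have := h {x, y, z} (by simp [insert_subset_iff, hx, hy, hz]) _ _ (.triple hxy hyz hxz)
  rwa [card_insert_of_notMem (by simp [hxy.ne, hxz]), card_pair hyz.ne] at this

theorem card_quadruple_le {X : Finset V} {k : ℕ}
    (h : ∀ T ⊆ X, ∀ c d, SpanPath G T c d → T.card ≤ k) {w x y z : V} (hw : w ∈ X) (hx : x ∈ X)
    (hy : y ∈ X) (hz : z ∈ X) (hwx : G.Adj w x) (hxy : G.Adj x y) (hyz : G.Adj y z)
    (hxz : x ≠ z) (hwy : w ≠ y) (hwz : w ≠ z) : 4 ≤ k := by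
  have hn : w ∉ ({x, y, z} : Finset V) := by simp [hwx.ne, hwy, hwz]
  have := h (insert w {x, y, z}) (by simp [insert_subset_iff, hw, hx, hy, hz]) _ _
    (.cons hn hwx (.triple hxy hyz hxz))
  rwa [card_insert_of_notMem hn, card_insert_of_notMem (by simp [hxy.ne, hxz]),
    card_pair hyz.ne] at this

/-- In a connected graph on 17 vertices without a path on nine vertices and with at least 46 edges,
the vertices outside the core are independent. -/
theorem core_compl_independent {U K : Finset V} (hU : Conn G U) (hcard : U.card = 17)
    (hf : PathFree G 9) (hsum : 91 ≤ degSum G U) (hKU : K ⊆ U) (hK : K.card = 5)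
    (hd : ∀ v ∈ K, 4 ≤ degIn G K v)
    (hmax : ∀ X ⊆ U, K ⊂ X → ∃ v ∈ X, v ∉ K ∧ degIn G X v < 4) :
    ∀ x ∈ U \ K, ∀ y ∈ U \ K, ¬ G.Adj x y := by
  have hKne : K.Nonempty := card_pos.1 (by omega)
  have hKt : Traceable G K K.card := traceable_of_minDegree hd (by omega)
  have hsum' : 92 ≤ degSum G U := by
    obtain ⟨e, he⟩ := even_degSum (G := G) U
    omega
  -- On `U` itself this is an equality, as `92 = 6 * 17 - 10`. Comparing with `U` minus one vertex,
  -- or minus two adjacent ones, gives the lower bounds `hone` and `htwo` on degrees.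
  have hrel : ∀ W ⊆ U, K ⊆ W → degSum G W + 10 ≤ 6 * W.card := fun W hW hKW => by
    have h1 := degSum_le_of_degenerate (G := G) (t := 3) hKW fun X hX hKX => by
      obtain ⟨v, hv, hvK, hlt⟩ := hmax X (hX.trans hW) hKX
      exact ⟨v, hv, hvK, by omega⟩
    have h2 := degSum_le (G := G) K
    rw [hK] at h1 h2
    omega
  have hone : ∀ t ∈ U \ K, 3 ≤ degIn G U t := fun t ht => by
    rw [mem_sdiff] at ht
    have h1 := hrel (U.erase t) (erase_subset _ _) (subset_erase.2 ⟨hKU, ht.2⟩)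
    have h2 := degSum_erase (G := G) ht.1
    rw [card_erase_of_mem ht.1] at h1
    omega
  have htwo : ∀ x ∈ U \ K, ∀ y ∈ U \ K, G.Adj x y → 7 ≤ degIn G U x + degIn G U y := by
    intro x hx y hy hxy
    rw [mem_sdiff] at hx hy
    have hyx : y ∈ U.erase x := mem_erase.2 ⟨hxy.ne', hy.1⟩
    have h1 := hrel ((U.erase x).erase y) ((erase_subset _ _).trans (erase_subset _ _))
      (subset_erase.2 ⟨subset_erase.2 ⟨hKU, hx.2⟩, hy.2⟩)
    have h2 := degSum_erase (G := G) hx.1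
    have h3 := degSum_erase (G := G) hyx
    have h4 : degIn G U y = degIn G (U.erase x) y + 1 := by
      conv_lhs => rw [← insert_erase hx.1]
      rw [degIn_insert (by simp), if_pos hxy.symm]
    rw [card_erase_of_mem hyx, card_erase_of_mem hx.1] at h1
    omega
  have hsplit : ∀ t, degIn G U t = degIn G K t + degIn G (U \ K) t := fun t => by
    conv_lhs => rw [← union_sdiff_of_subset hKU]
    exact degIn_union disjoint_sdiff t
  have hT : (U \ K).card = 12 := by rw [card_sdiff_of_subset hKU]; omega
  have hdisj : ∀ S ⊆ U \ K, Disjoint S K := fun S hS => disjoint_sdiff_self_left.mono_left hS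
  have hnot : ∀ v ∈ U \ K, Disjoint {v} K := fun v hv => by simpa using (mem_sdiff.1 hv).2
  obtain ⟨S, hS, a, b, hp, ha, hb, hlong⟩ :=
    exists_longest (G := G) (X := U \ K) (card_pos.1 (by omega))
  obtain ⟨-, hSc⟩ := hp.attached hU hf Subset.rfl hKU hS hKne hKt (r := 3) (by omega) (by omega)
    ha (hone a (hS hp.left_mem))
  -- A longest path outside the core has at most three vertices. Three of them will turn out to form
  -- a triangle with both ends of degree three, against `htwo`.
  by_cases hS3 : S.card = 3
  · exfalso
    have hpend : ∀ w ∈ U \ K, ∀ u₁ ∈ U \ K, ∀ u₂ ∈ U \ K, ∀ u₃ ∈ U \ K, G.Adj w u₁ →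
        G.Adj w u₂ → G.Adj w u₃ → u₁ ≠ u₂ → u₁ ≠ u₃ → u₂ ≠ u₃ → 2 ≤ degIn G K u₁ := by
      intro w hw u₁ h₁ u₂ h₂ u₃ h₃ hw₁ hw₂ hw₃ h₁₂ h₁₃ h₂₃
      by_contra hlt
      have h5 := hsplit u₁
      have h6 := hone u₁ h₁
      obtain ⟨v, hv, hvw, huv⟩ :=
        exists_adj_ne_of_two_le (G := G) (U := U \ K) (v := u₁) (by omega) w
      by_cases hv₂ : v = u₂
      · have := card_quadruple_le hlong hv h₁ hw h₃ huv.symm hw₁.symm hw₃ h₁₃ hvw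
          (hv₂ ▸ h₂₃)
        omega
      · have := card_quadruple_le hlong hv h₁ hw h₂ huv.symm hw₁.symm hw₂ h₁₂ hvw hv₂
        omega
    -- With three outer neighbours of `w`, the path `u₃`, `w`, `u₁`, all of `K`, `u₂` would have `3
    -- + 5 + 1` vertices.
    have hle2 : ∀ w ∈ U \ K, degIn G (U \ K) w ≤ 2 := by
      intro w hw
      by_contra! h3
      obtain ⟨u₁, h₁, u₂, h₂, u₃, h₃, h₁₂, h₁₃, h₂₃⟩ := two_lt_card.1 h3
      simp only [mem_filter] at h₁ h₂ h₃
      have h4 := hpend w hw u₁ h₁.1 u₂ h₂.1 u₃ h₃.1 h₁.2 h₂.2 h₃.2 h₁₂ h₁₃ h₂₃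
      have h5 := hpend w hw u₂ h₂.1 u₁ h₁.1 u₃ h₃.1 h₂.2 h₁.2 h₃.2 h₁₂.symm h₂₃ h₁₃
      obtain ⟨p, hpK, hup⟩ := exists_adj_of_degIn_pos (G := G) (U := K) (v := u₁) (by omega)
      obtain ⟨q, hqK, hqp, huq⟩ := exists_adj_ne_of_two_le h5 p
      have h6 := card_add_add_lt hd (by omega) hf (.triple h₃.2.symm h₁.2 h₁₃.symm)
        (.single u₂) (hdisj _ (by
          rw [insert_subset_iff, insert_subset_iff, singleton_subset_iff]
          exact ⟨h₃.1, hw, h₁.1⟩)) (hnot _ h₂.1)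
        (by simp [h₂₃, h₂.2.ne', h₁₂.symm]) hpK hqK hqp.symm hup huq
      rw [card_insert_of_notMem (by simp [h₃.2.ne', h₁₃.symm]), card_pair h₁.2.ne,
        card_singleton] at h6
      omega
    obtain ⟨z, hz, hzS⟩ : ∃ z ∈ U \ K, z ∉ S := by
      by_contra! hcon
      have := card_le_card (fun z hz => hcon z hz : U \ K ⊆ S)
      omega
    have hz1 := hone z hz
    rw [hsplit] at hz1
    have hz2 := hle2 z hz
    obtain ⟨q, hqK, hzq⟩ := exists_adj_of_degIn_pos (G := G) (U := K) (v := z) (by omega)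
    have hend : ∀ a b, SpanPath G S a b → degIn G K a ≤ 1 := by
      intro a b hp
      by_contra! h2
      obtain ⟨p, hpK, hpq, hap⟩ := exists_adj_ne_of_two_le h2 q
      have := card_add_add_lt hd (by omega) hf hp.symm (.single z) (hdisj _ hS) (hnot _ hz)
        (by simpa using hzS) hpK hqK hpq hap hzq
      rw [card_singleton] at this
      omega
    have haT := hS hp.left_mem
    have hbT := hS hp.right_mem
    have ha1 := hend a b hp
    have hb1 := hend b a hp.symm
    have ha2 := hone a haT
    have ha3 := hle2 a haT
    have hb3 := hle2 b hbT
    have hsa := hsplit a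
    have hsb := hsplit b
    have hab : a ≠ b := by
      rintro rfl
      rw [hp.eq_singleton, card_singleton] at hS3
      omega
    have hadj : G.Adj a b := by
      have h4 : 2 ≤ #{v ∈ S | G.Adj a v} :=
        le_trans (by omega) (degIn_le_of_forall ha)
      by_contra hnadj
      have h5 : {v ∈ S | G.Adj a v} ⊆ (S.erase a).erase b := fun v hv => by
        rw [mem_filter] at hv
        refine mem_erase.2 ⟨?_, mem_erase.2 ⟨hv.2.ne', hv.1⟩⟩
        rintro rfl
        exact hnadj hv.2
      have h6 := card_le_card h5
      rw [card_erase_of_mem (mem_erase.2 ⟨hab.symm, hp.right_mem⟩),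
        card_erase_of_mem hp.left_mem] at h6
      omega
    have := htwo a haT b hbT hadj
    omega
  have hle1 : ∀ w ∈ U \ K, degIn G (U \ K) w ≤ 1 := by
    intro w hw
    by_contra! h2
    obtain ⟨x, hx, y, hy, hxy⟩ := one_lt_card.1 h2
    simp only [mem_filter] at hx hy
    have := card_triple_le hlong hx.1 hw hy.1 hx.2.symm hy.2 hxy
    omega
  have key : ∀ x ∈ U \ K, ∀ y ∈ U \ K, G.Adj x y → 3 ≤ degIn G K x → False := by
    intro x hx y hy hxy hx3
    have hdis2 : Disjoint {y, x} K := hdisj _ (by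
      rw [insert_subset_iff, singleton_subset_iff]
      exact ⟨hy, hx⟩)
    -- Otherwise `v` has an outer partner `v'`, and the edges `y x` and `v v'` are joined through
    -- `K` into a path on `2 + 5 + 2` vertices.
    have hout : ∀ v ∈ U \ K, v ≠ x → v ≠ y → 3 ≤ degIn G K v := by
      intro v hv hvx hvy
      by_contra hlt
      have h1 := hone v hv
      rw [hsplit] at h1
      obtain ⟨v', hv', hvv'⟩ := exists_adj_of_degIn_pos (G := G) (U := U \ K) (v := v) (by omega)
      have h2 := hle1 v hv
      have hv'x : v' ≠ x := by
        rintro rfl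
        have := two_le_degIn hv hy hvy hvv'.symm hxy
        have := hle1 v' hx
        omega
      have hv'y : v' ≠ y := by
        rintro rfl
        have := two_le_degIn hv hx hvx hvv'.symm hxy.symm
        have := hle1 v' hy
        omega
      obtain ⟨p, hpK, hxp⟩ := exists_adj_of_degIn_pos (G := G) (U := K) (v := x) (by omega)
      obtain ⟨q, hqK, hqp, hvq⟩ :=
        exists_adj_ne_of_two_le (G := G) (U := K) (v := v) (by omega) p
      have := card_add_add_lt hd (by omega) hf (.pair hxy.symm) (.pair hvv') hdis2
        (hdisj _ (by
          rw [insert_subset_iff, singleton_subset_iff]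
          exact ⟨hv, hv'⟩))
        (by simp [hvx, hvy, hv'x, hv'y]) hpK hqK hqp.symm hxp hvq
      rw [card_pair hxy.ne', card_pair hvv'.ne] at this
      omega
    have hcard' : 1 < (((U \ K).erase x).erase y).card := by
      rw [card_erase_of_mem (mem_erase.2 ⟨hxy.ne', hy⟩), card_erase_of_mem hx]
      omega
    obtain ⟨v, hv, w, hw, hvw⟩ := one_lt_card.1 hcard'
    simp only [mem_erase] at hv hw
    have hv3 := hout v hv.2.2 hv.2.1 hv.1
    have hw3 := hout w hw.2.2 hw.2.1 hw.1
    -- As `3 + 3 > 5`, `x` and `v` share a neighbour `p`; the path `y`, `x`, `p`, `v`, the rest of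
    -- `K`, `w` has nine vertices.
    obtain ⟨p, hpK, hxp, hvp⟩ := exists_common_of_card_lt (G := G) (K := K) (x := x) (y := v)
      (by omega)
    have := card_add_lt_of_insertion hd (by omega) hf (.pair hxy.symm) hdis2
      (by simp [hv.1, hv.2.1]) (by simp [hw.1, hw.2.1]) (mem_sdiff.1 hv.2.2).2
      (mem_sdiff.1 hw.2.2).2 hvw hpK hxp hvp hv3 (by omega)
    rw [card_pair hxy.ne'] at this
    omega
  intro x hx y hy hxy
  have h1 := htwo x hx y hy hxy
  rw [hsplit, hsplit] at h1
  have h2 := hle1 x hx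
  have h3 := hle1 y hy
  by_cases h4 : 3 ≤ degIn G K x
  · exact key x hx y hy hxy h4
  · exact key y hy x hx hxy.symm (by omega)

end

/-! ### Alternating paths in bipartite graphs. -/

section

variable {V : Type*} [DecidableEq V] {G : SimpleGraph V} [DecidableRel G.Adj]

/-- `x` and `y` have no common neighbour in `O`. -/
def NoShare (G : SimpleGraph V) (O : Finset V) (x y : V) : Prop :=
  ∀ u ∈ O, G.Adj x u → ¬ G.Adj y u

theorem NoShare.symm {O : Finset V} {x y : V} (h : NoShare G O x y) : NoShare G O y x :=
  fun u hu hy hx => h u hu hx hy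

theorem sum_degIn_le {O : Finset V} {l : List V} (h : l.Pairwise (NoShare G O)) :
    (l.map (degIn G O)).sum ≤ O.card := by
  induction l generalizing O with
  | nil => simp
  | cons x l ih =>
    rw [List.pairwise_cons] at h
    have h1 : ∀ y ∈ l, degIn G O y = degIn G {u ∈ O | ¬ G.Adj x u} y := fun y hy => by
      rw [degIn, degIn, filter_filter]
      congr 1
      refine filter_congr fun u hu => ?_
      exact ⟨fun hyu => ⟨fun hxu => h.1 y hy u hu hxu hyu, hyu⟩, And.right⟩
    have h2 := ih (O := {u ∈ O | ¬ G.Adj x u})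
      (h.2.imp fun hab u hu => hab u (mem_filter.1 hu).1)
    rw [List.map_cons, List.sum_cons, List.map_congr_left h1,
      ← card_filter_add_card_filter_not (s := O) (fun u => G.Adj x u)]
    exact Nat.add_le_add_left h2 _

/-- An edge between `x ∈ X` and `y ∈ Y`. -/
def Link (G : SimpleGraph V) (X Y : Finset V) (x y : V) : Prop :=
  x ∈ X ∧ y ∈ Y ∧ G.Adj x y

variable {X Y : Finset V} {m : ℕ}

/-- A path alternating between `X` and `Y`. -/
def Alt3 (G : SimpleGraph V) (X Y : Finset V) (a p b q c : V) : Prop :=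
  [a, b, c].Nodup ∧ [p, q].Nodup ∧ Link G X Y a p ∧ Link G X Y b p ∧ Link G X Y b q ∧
    Link G X Y c q

/-- A path alternating between `X` and `Y`. -/
def Alt4 (G : SimpleGraph V) (X Y : Finset V) (a p b q c r d : V) : Prop :=
  [a, b, c, d].Nodup ∧ [p, q, r].Nodup ∧ Link G X Y a p ∧ Link G X Y b p ∧ Link G X Y b q ∧
    Link G X Y c q ∧ Link G X Y c r ∧ Link G X Y d r

/-- A path alternating between `X` and `Y`. -/
def Alt5 (G : SimpleGraph V) (X Y : Finset V) (a p b q c r d s e : V) : Prop :=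
  [a, b, c, d, e].Nodup ∧ [p, q, r, s].Nodup ∧ Link G X Y a p ∧ Link G X Y b p ∧ Link G X Y b q ∧
    Link G X Y c q ∧ Link G X Y c r ∧ Link G X Y d r ∧ Link G X Y d s ∧ Link G X Y e s

theorem exists_link_common {O : Finset V} (hO : O ⊆ Y) {x y : V} (hx : x ∈ X) (hy : y ∈ X)
    (h : O.card < degIn G O x + degIn G O y) :
    ∃ p ∈ O, Link G X Y x p ∧ Link G X Y y p := by
  obtain ⟨p, hp, hxp, hyp⟩ := exists_common_of_card_lt h
  exact ⟨p, hp, ⟨hx, hO hp, hxp⟩, ⟨hy, hO hp, hyp⟩⟩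

theorem degIn_le_sdiff_add {P : Finset V} (x : V) :
    degIn G Y x ≤ degIn G (Y \ P) x + degIn G P x := by
  rw [← degIn_union disjoint_sdiff_self_left]
  exact degIn_mono (by simp) x

theorem degIn_eq_zero {P : Finset V} {x : V} (h : ∀ p ∈ P, ¬ G.Adj x p) : degIn G P x = 0 := by
  rw [degIn, card_eq_zero, filter_eq_empty_iff]
  exact h

theorem adj_of_card_le_degIn {P : Finset V} {x : V} (h : P.card ≤ degIn G P x) :
    ∀ p ∈ P, G.Adj x p := by
  have := eq_of_subset_of_card_le (filter_subset (fun w => G.Adj x w) P) h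
  exact fun p hp => (mem_filter.1 (this.symm ▸ hp : p ∈ filter (fun w => G.Adj x w) P)).2

/-- Two vertices of `X` share a neighbour `p`. If no third vertex could be attached, three sets of
`m - 1` neighbours would be disjoint in the at most `2 * m - 2` vertices other than `p`. -/
theorem exists_alt3 (hm : 2 ≤ m) (hX : 3 ≤ X.card) (hY : Y.card + 1 ≤ 2 * m)
    (hd : ∀ x ∈ X, m ≤ degIn G Y x) : ∃ a p b q c, Alt3 G X Y a p b q c := by
  by_contra! hno
  obtain ⟨a, ha, b, hb, z, hz, hab, haz, hbz⟩ := two_lt_card.1 hX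
  have hda := hd a ha
  have hdb := hd b hb
  have hdz := hd z hz
  obtain ⟨p, hp, hap, hbp⟩ := exists_link_common (G := G) (X := X) Subset.rfl ha hb
    (by omega : Y.card < _)
  have hc : (Y \ {p}).card = Y.card - 1 := by
    rw [card_sdiff_of_subset (by simpa using hp), card_singleton]
  have hYpos := card_pos.2 ⟨p, hp⟩
  have hdeg : ∀ x, degIn G Y x ≤ degIn G (Y \ {p}) x + 1 := fun x =>
    (degIn_le_sdiff_add x).trans (Nat.add_le_add_left (degIn_le_card.trans (by simp)) _)
  have ha' := hdeg a
  have hb' := hdeg b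
  have hz' := hdeg z
  have hza : NoShare G (Y \ {p}) z a := fun u hu hzu hau => by
    rw [mem_sdiff, mem_singleton] at hu
    exact hno z u a p b ⟨by grind, by grind, ⟨hz, hu.1, hzu⟩, ⟨ha, hu.1, hau⟩, hap, hbp⟩
  have hzb : NoShare G (Y \ {p}) z b := fun u hu hzu hbu => by
    rw [mem_sdiff, mem_singleton] at hu
    exact hno z u b p a ⟨by grind, by grind, ⟨hz, hu.1, hzu⟩, ⟨hb, hu.1, hbu⟩, hbp, hap⟩
  have hab' : NoShare G (Y \ {p}) a b := fun u hu hau hbu => by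
    have hu' := hu
    rw [mem_sdiff, mem_singleton] at hu'
    by_cases hzp : G.Adj z p
    · exact hno z p a u b ⟨by grind, by grind, ⟨hz, hp, hzp⟩, hap, ⟨ha, hu'.1, hau⟩,
        ⟨hb, hu'.1, hbu⟩⟩
    · have h1 := degIn_le_sdiff_add (G := G) (Y := Y) (P := {p}) z
      rw [degIn_eq_zero (P := {p}) (by simpa using hzp)] at h1
      obtain ⟨v, hv, hzv, hav⟩ := exists_common_of_card_lt (G := G) (K := Y \ {p}) (x := z)
        (y := a) (by omega)
      exact hza v hv hzv hav
  have := sum_degIn_le (G := G) (O := Y \ {p}) (l := [z, a, b]) (by simp [hza, hzb, hab'])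
  simp only [List.map_cons, List.map_nil, List.sum_cons, List.sum_nil] at this
  omega

/-- A new vertex shared by `z` and an end prolongs the path. One shared by both ends closes a cycle,
which can be opened next to any neighbour of `z` on it; if `z` has none, counting makes `z` and `a`
share a neighbour off the path. `Alt4.noShare` is the same argument one step longer. -/
theorem Alt3.noShare (hY : Y.card + 1 ≤ 2 * m) (hd : ∀ x ∈ X, m ≤ degIn G Y x)
    (hno : ∀ a p b q c r d, ¬ Alt4 G X Y a p b q c r d) {a p b q c z : V}
    (h : Alt3 G X Y a p b q c) (hz : z ∈ X) (hn : [a, b, c, z].Nodup) :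
    NoShare G (Y \ {p, q}) z a ∧ NoShare G (Y \ {p, q}) z c ∧ NoShare G (Y \ {p, q}) a c := by
  obtain ⟨-, hn', hap, hbp, hbq, hcq⟩ := h
  have hza : NoShare G (Y \ {p, q}) z a := fun u hu hzu hau => by
    simp only [mem_sdiff, mem_insert, mem_singleton] at hu
    exact hno z u a p b q c ⟨by grind, by grind, ⟨hz, hu.1, hzu⟩, ⟨hap.1, hu.1, hau⟩, hap, hbp,
      hbq, hcq⟩
  have hzc : NoShare G (Y \ {p, q}) z c := fun u hu hzu hcu => by
    simp only [mem_sdiff, mem_insert, mem_singleton] at hu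
    exact hno z u c q b p a ⟨by grind, by grind, ⟨hz, hu.1, hzu⟩, ⟨hcq.1, hu.1, hcu⟩, hcq, hbq,
      hbp, hap⟩
  refine ⟨hza, hzc, fun u hu hau hcu => ?_⟩
  simp only [mem_sdiff, mem_insert, mem_singleton] at hu
  have hau' : Link G X Y a u := ⟨hap.1, hu.1, hau⟩
  have hcu' : Link G X Y c u := ⟨hcq.1, hu.1, hcu⟩
  by_cases hzp : G.Adj z p
  · exact hno z p a u c q b ⟨by grind, by grind, ⟨hz, hap.2.1, hzp⟩, hap, hau', hcu', hcq, hbq⟩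
  by_cases hzq : G.Adj z q
  · exact hno z q c u a p b ⟨by grind, by grind, ⟨hz, hcq.2.1, hzq⟩, hcq, hcu', hau', hap, hbp⟩
  have h1 := degIn_le_sdiff_add (G := G) (Y := Y) (P := {p, q}) z
  rw [degIn_eq_zero (P := {p, q}) (by simp [hzp, hzq])] at h1
  have h2 := degIn_le_sdiff_add (G := G) (Y := Y) (P := {p, q}) a
  have h3 : degIn G {p, q} a ≤ 2 := degIn_le_card.trans card_le_two
  have hpq : p ≠ q := by simpa using hn'
  have h4 := card_sdiff_of_subset (s := {p, q}) (t := Y) (by simp [insert_subset_iff, hap.2.1, hcq.2.1])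
  rw [card_pair hpq] at h4
  have h5 := card_pair hpq ▸ card_le_card (show {p, q} ⊆ Y by simp [insert_subset_iff, hap.2.1, hcq.2.1])
  have h6 := hd z hz
  have h7 := hd a hap.1
  obtain ⟨v, hv, hzv, hav⟩ := exists_common_of_card_lt (G := G) (K := Y \ {p, q}) (x := z)
    (y := a) (by omega)
  exact hza v hv hzv hav

theorem Alt4.noShare (hY : Y.card + 1 ≤ 2 * m) (hd : ∀ x ∈ X, m ≤ degIn G Y x)
    (hno : ∀ a p b q c r d s e, ¬ Alt5 G X Y a p b q c r d s e) {a p b q c r d z : V}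
    (h : Alt4 G X Y a p b q c r d) (hz : z ∈ X) (hn : [a, b, c, d, z].Nodup) :
    NoShare G (Y \ {p, q, r}) z a ∧ NoShare G (Y \ {p, q, r}) z d ∧
      NoShare G (Y \ {p, q, r}) a d := by
  obtain ⟨-, hn', hap, hbp, hbq, hcq, hcr, hdr⟩ := h
  have hza : NoShare G (Y \ {p, q, r}) z a := fun u hu hzu hau => by
    simp only [mem_sdiff, mem_insert, mem_singleton] at hu
    exact hno z u a p b q c r d ⟨by grind, by grind, ⟨hz, hu.1, hzu⟩, ⟨hap.1, hu.1, hau⟩, hap, hbp,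
      hbq, hcq, hcr, hdr⟩
  have hzd : NoShare G (Y \ {p, q, r}) z d := fun u hu hzu hdu => by
    simp only [mem_sdiff, mem_insert, mem_singleton] at hu
    exact hno z u d r c q b p a ⟨by grind, by grind, ⟨hz, hu.1, hzu⟩, ⟨hdr.1, hu.1, hdu⟩, hdr, hcr,
      hcq, hbq, hbp, hap⟩
  refine ⟨hza, hzd, fun u hu hau hdu => ?_⟩
  simp only [mem_sdiff, mem_insert, mem_singleton] at hu
  have hau' : Link G X Y a u := ⟨hap.1, hu.1, hau⟩
  have hdu' : Link G X Y d u := ⟨hdr.1, hu.1, hdu⟩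
  by_cases hzp : G.Adj z p
  · exact hno z p a u d r c q b ⟨by grind, by grind, ⟨hz, hap.2.1, hzp⟩, hap, hau', hdu', hdr, hcr,
      hcq, hbq⟩
  by_cases hzq : G.Adj z q
  · exact hno z q b p a u d r c ⟨by grind, by grind, ⟨hz, hcq.2.1, hzq⟩, hbq, hbp, hap, hau', hdu',
      hdr, hcr⟩
  by_cases hzr : G.Adj z r
  · exact hno z r d u a p b q c ⟨by grind, by grind, ⟨hz, hdr.2.1, hzr⟩, hdr, hdu', hau', hap, hbp,
      hbq, hcq⟩
  have h1 := degIn_le_sdiff_add (G := G) (Y := Y) (P := {p, q, r}) z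
  rw [degIn_eq_zero (P := {p, q, r}) (by simp [hzp, hzq, hzr])] at h1
  have h2 := degIn_le_sdiff_add (G := G) (Y := Y) (P := {p, q, r}) a
  have h3 : degIn G {p, q, r} a ≤ 3 := degIn_le_card.trans card_le_three
  have hc3 : ({p, q, r} : Finset V).card = 3 := card_eq_three.2 ⟨p, q, r, by grind, by grind, by grind, rfl⟩
  have hsub : {p, q, r} ⊆ Y := by simp [insert_subset_iff, hap.2.1, hcq.2.1, hdr.2.1]
  have h4 := card_sdiff_of_subset hsub
  have h5 := card_le_card hsub
  have h6 := hd z hz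
  have h7 := hd a hap.1
  obtain ⟨v, hv, hzv, hav⟩ := exists_common_of_card_lt (G := G) (K := Y \ {p, q, r}) (x := z)
    (y := a) (by omega)
  exact hza v hv hzv hav

theorem exists_not_mem_of_length_lt (l : List V) (h : l.length < X.card) : ∃ z ∈ X, z ∉ l := by
  by_contra! hcon
  have := card_le_card (fun z hz => List.mem_toFinset.2 (hcon z hz) : X ⊆ l.toFinset)
  have := l.toFinset_card_le
  omega

/-- The disjoint neighbourhoods of `z`, `a`, `c` off `{p, q}` only fit if all three are adjacent to
both `p` and `q`. Then the path can be rearranged to make `b` an end, and four disjoint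
neighbourhoods no longer fit. -/
theorem exists_alt4 (hm : m = 3 ∨ m = 4) (hX : 4 ≤ X.card) (hY : Y.card + 1 ≤ 2 * m)
    (hd : ∀ x ∈ X, m ≤ degIn G Y x) : ∃ a p b q c r d, Alt4 G X Y a p b q c r d := by
  by_contra! hno
  obtain ⟨a, p, b, q, c, h⟩ := exists_alt3 (by omega) (by omega) hY hd
  obtain ⟨hn, hn', hap, hbp, hbq, hcq⟩ := id h
  obtain ⟨z, hz, hzl⟩ := exists_not_mem_of_length_lt (X := X) [a, b, c] (by simpa using Nat.lt_of_succ_le hX)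
  obtain ⟨hza, hzc, hac⟩ := h.noShare hY hd hno hz (by grind)
  have hpq : p ≠ q := by simpa using hn'
  have hsub : {p, q} ⊆ Y := by simp [insert_subset_iff, hap.2.1, hcq.2.1]
  have h4 := card_sdiff_of_subset hsub
  have h5 := card_le_card hsub
  rw [card_pair hpq] at h4 h5
  have hdeg : ∀ x ∈ X, m ≤ degIn G (Y \ {p, q}) x + degIn G {p, q} x := fun x hx =>
    (hd x hx).trans (degIn_le_sdiff_add x)
  have hle : ∀ x, degIn G {p, q} x ≤ 2 := fun x => degIn_le_card.trans card_le_two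
  have hsum := sum_degIn_le (G := G) (O := Y \ {p, q}) (l := [z, a, c]) (by simp [hza, hzc, hac])
  simp only [List.map_cons, List.map_nil, List.sum_cons, List.sum_nil] at hsum
  have hz1 := hdeg z hz
  have ha1 := hdeg a hap.1
  have hc1 := hdeg c hcq.1
  have hb1 := hdeg b hbq.1
  have hz2 := hle z
  have ha2 := hle a
  have hc2 := hle c
  have hb2 := hle b
  have hfull : ∀ x, 2 ≤ degIn G {p, q} x → G.Adj x p ∧ G.Adj x q := fun x hx => by
    simpa using adj_of_card_le_degIn ((card_pair hpq).trans_le hx)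
  obtain ⟨hzp, hzq⟩ := hfull z (by omega)
  obtain ⟨-, haq⟩ := hfull a (by omega)
  obtain ⟨hcp, -⟩ := hfull c (by omega)
  have hzp' : Link G X Y z p := ⟨hz, hap.2.1, hzp⟩
  have hzq' : Link G X Y z q := ⟨hz, hcq.2.1, hzq⟩
  have haq' : Link G X Y a q := ⟨hap.1, hcq.2.1, haq⟩
  have hcp' : Link G X Y c p := ⟨hcq.1, hap.2.1, hcp⟩
  have hbz : NoShare G (Y \ {p, q}) b z := fun u hu hbu hzu => by
    simp only [mem_sdiff, mem_insert, mem_singleton] at hu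
    exact hno a p z u b q c ⟨by grind, by grind, hap, hzp', ⟨hz, hu.1, hzu⟩, ⟨hbq.1, hu.1, hbu⟩, hbq,
      hcq⟩
  have hba : NoShare G (Y \ {p, q}) b a := fun u hu hbu hau => by
    simp only [mem_sdiff, mem_insert, mem_singleton] at hu
    exact hno z p b u a q c ⟨by grind, by grind, hzp', hbp, ⟨hbq.1, hu.1, hbu⟩, ⟨hap.1, hu.1, hau⟩,
      haq', hcq⟩
  have hbc : NoShare G (Y \ {p, q}) b c := fun u hu hbu hcu => by
    simp only [mem_sdiff, mem_insert, mem_singleton] at hu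
    exact hno z q b u c p a ⟨by grind, by grind, hzq', hbq, ⟨hbq.1, hu.1, hbu⟩, ⟨hcq.1, hu.1, hcu⟩,
      hcp', hap⟩
  have hsum := sum_degIn_le (G := G) (O := Y \ {p, q}) (l := [b, z, a, c])
    (by simp [hza, hzc, hac, hba, hbc, hbz])
  simp only [List.map_cons, List.map_nil, List.sum_cons, List.sum_nil] at hsum
  omega

/-- If the first vertex of an alternating path and the vertex `z` are adjacent to all of its
vertices in `Y`, the path can be prolonged. -/
theorem Alt4.false_of_full
    (hno : ∀ a p b q c r d s e, ¬ Alt5 G X Y a p b q c r d s e) {O : Finset V} {a p b q c r d z : V}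
    (hO : O ⊆ Y \ {p, q, r}) (hOc : O.card ≤ 4) (hd : ∀ x ∈ X, 1 ≤ degIn G O x)
    (h : Alt4 G X Y a p b q c r d) (hz : z ∈ X) (hn : [a, b, c, d, z].Nodup)
    (hza : NoShare G O z a) (hzd : NoShare G O z d) (had : NoShare G O a d)
    (haf : G.Adj a q ∧ G.Adj a r) (hzf : G.Adj z p ∧ G.Adj z q ∧ G.Adj z r) : False := by
  obtain ⟨-, hn', hap, hbp, hbq, hcq, hcr, hdr⟩ := h
  have haq : Link G X Y a q := ⟨hap.1, hbq.2.1, haf.1⟩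
  have har : Link G X Y a r := ⟨hap.1, hcr.2.1, haf.2⟩
  have hzp : Link G X Y z p := ⟨hz, hap.2.1, hzf.1⟩
  have hzq : Link G X Y z q := ⟨hz, hbq.2.1, hzf.2.1⟩
  have hzr : Link G X Y z r := ⟨hz, hcr.2.1, hzf.2.2⟩
  have hO' : ∀ u ∈ O, u ∈ Y ∧ u ≠ p ∧ u ≠ q ∧ u ≠ r := fun u hu => by
    simpa using hO hu
  have hzb : NoShare G O z b := fun u hu hzu hbu => by
    have hu := hO' u hu
    exact hno z u b p a q c r d ⟨by grind, by grind, ⟨hz, hu.1, hzu⟩, ⟨hbp.1, hu.1, hbu⟩, hbp, hap,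
      haq, hcq, hcr, hdr⟩
  have hzc : NoShare G O z c := fun u hu hzu hcu => by
    have hu := hO' u hu
    exact hno z u c q b p a r d ⟨by grind, by grind, ⟨hz, hu.1, hzu⟩, ⟨hcq.1, hu.1, hcu⟩, hcq, hbq,
      hbp, hap, har, hdr⟩
  have hab : NoShare G O a b := fun u hu hau hbu => by
    have hu := hO' u hu
    exact hno b u a p z q c r d ⟨by grind, by grind, ⟨hbp.1, hu.1, hbu⟩, ⟨hap.1, hu.1, hau⟩, hap, hzp,
      hzq, hcq, hcr, hdr⟩
  have hbd : NoShare G O b d := fun u hu hbu hdu => by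
    have hu := hO' u hu
    exact hno b u d r c q z p a ⟨by grind, by grind, ⟨hbp.1, hu.1, hbu⟩, ⟨hdr.1, hu.1, hdu⟩, hdr, hcr,
      hcq, hzq, hzp, hap⟩
  have hbc : NoShare G O b c := fun u hu hbu hcu => by
    have hu := hO' u hu
    exact hno b u c q z p a r d ⟨by grind, by grind, ⟨hbp.1, hu.1, hbu⟩, ⟨hcq.1, hu.1, hcu⟩, hcq, hzq,
      hzp, hap, har, hdr⟩
  have hac : NoShare G O a c := fun u hu hau hcu => by
    have hu := hO' u hu
    exact hno c u a p b q z r d ⟨by grind, by grind, ⟨hcq.1, hu.1, hcu⟩, ⟨hap.1, hu.1, hau⟩, hap, hbp,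
      hbq, hzq, hzr, hdr⟩
  have hcd : NoShare G O c d := fun u hu hcu hdu => by
    have hu := hO' u hu
    exact hno c u d r z q b p a ⟨by grind, by grind, ⟨hcq.1, hu.1, hcu⟩, ⟨hdr.1, hu.1, hdu⟩, hdr, hzr,
      hzq, hbq, hbp, hap⟩
  have hsum := sum_degIn_le (G := G) (O := O) (l := [z, a, b, c, d])
    (by simp [hza, hzb, hzc, hzd, hab, hac, had, hbc, hbd, hcd])
  simp only [List.map_cons, List.map_nil, List.sum_cons, List.sum_nil] at hsum
  have := hd a hap.1
  have := hd b hbp.1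
  have := hd c hcq.1
  have := hd d hdr.1
  have := hd z hz
  omega

end

/-! ### Jackson's theorem for paths, bipartite Ramsey, closed sets. -/

section

variable {V : Type*} [DecidableEq V] {G : SimpleGraph V} [DecidableRel G.Adj] {X Y : Finset V}

/-- Off `p`, `q`, `r` at most four vertices of `Y` remain for the disjoint neighbourhoods of `z`,
`a`, `d`, so at least two of these are adjacent to all of `p`, `q`, `r`. If `z` is one of them,
`Alt4.false_of_full` applies, perhaps to the reversed path; if not, rotations make `b` an end and
four neighbourhoods are too many. -/
theorem exists_alt5 (hX : 5 ≤ X.card) (hY : Y.card ≤ 7) (hd : ∀ x ∈ X, 4 ≤ degIn G Y x) :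
    ∃ a p b q c r d s e, Alt5 G X Y a p b q c r d s e := by
  by_contra! hno
  obtain ⟨a, p, b, q, c, r, d, h⟩ := exists_alt4 (m := 4) (by omega) (by omega) (by omega) hd
  obtain ⟨hn, hn', hap, hbp, hbq, hcq, hcr, hdr⟩ := id h
  obtain ⟨z, hz, hzl⟩ := exists_not_mem_of_length_lt (X := X) [a, b, c, d]
    (by simpa using Nat.lt_of_succ_le hX)
  have hnz : [a, b, c, d, z].Nodup := by grind
  obtain ⟨hza, hzd, had⟩ := h.noShare (m := 4) (by omega) hd hno hz hnz
  have hc3 : ({p, q, r} : Finset V).card = 3 :=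
    card_eq_three.2 ⟨p, q, r, by grind, by grind, by grind, rfl⟩
  have hsub : {p, q, r} ⊆ Y := by simp [insert_subset_iff, hap.2.1, hcq.2.1, hdr.2.1]
  have hOc := card_sdiff_of_subset hsub
  have hle : ∀ x, degIn G {p, q, r} x ≤ 3 := fun x => degIn_le_card.trans card_le_three
  have hdeg : ∀ x ∈ X, 4 ≤ degIn G (Y \ {p, q, r}) x + degIn G {p, q, r} x := fun x hx =>
    (hd x hx).trans (degIn_le_sdiff_add x)
  have hone : ∀ x ∈ X, 1 ≤ degIn G (Y \ {p, q, r}) x := fun x hx => by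
    have := hle x
    have := hdeg x hx
    omega
  have hfull : ∀ x ∈ X, degIn G (Y \ {p, q, r}) x ≤ 1 → G.Adj x p ∧ G.Adj x q ∧ G.Adj x r := by
    intro x hx h1
    have h2 := hdeg x hx
    simpa using adj_of_card_le_degIn (G := G) (P := {p, q, r}) (x := x) (by omega)
  have hsum := sum_degIn_le (G := G) (l := [z, a, d]) (by simpa using ⟨⟨hza, hzd⟩, had⟩)
  simp only [List.map_cons, List.map_nil, List.sum_cons, List.sum_nil] at hsum
  have hz1 := hone z hz
  have ha1 := hone a hap.1
  have hd1 := hone d hdr.1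
  by_cases hzle : degIn G (Y \ {p, q, r}) z ≤ 1
  · obtain ⟨hzp, hzq, hzr⟩ := hfull z hz hzle
    by_cases hale : degIn G (Y \ {p, q, r}) a ≤ 1
    · exact h.false_of_full hno Subset.rfl (by omega) hone hz hnz hza hzd had
        (hfull a hap.1 hale).2 ⟨hzp, hzq, hzr⟩
    · obtain ⟨hdp, hdq, -⟩ := hfull d hdr.1 (by omega)
      have h' : Alt4 G X Y d r c q b p a := ⟨by grind, by grind, hdr, hcr, hcq, hbq, hbp, hap⟩
      exact h'.false_of_full hno (fun u hu => by
        simp only [mem_sdiff, mem_insert, mem_singleton] at hu ⊢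
        tauto) (by omega) hone hz (by grind) hzd hza had.symm ⟨hdq, hdp⟩ ⟨hzr, hzq, hzp⟩
  · obtain ⟨-, haq, -⟩ := hfull a hap.1 (by omega)
    obtain ⟨hdp, -, -⟩ := hfull d hdr.1 (by omega)
    have h₁ : Alt4 G X Y b p a q c r d :=
      ⟨by grind, by grind, hbp, hap, ⟨hap.1, hbq.2.1, haq⟩, hcq, hcr, hdr⟩
    have h₂ : Alt4 G X Y a p d r c q b :=
      ⟨by grind, by grind, hap, ⟨hdr.1, hap.2.1, hdp⟩, hdr, hcr, hcq, hbq⟩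
    obtain ⟨hzb, -, hbd⟩ := h₁.noShare (m := 4) (by omega) hd hno hz (by grind)
    obtain ⟨-, -, hab⟩ := h₂.noShare (m := 4) (by omega) hd hno hz (by grind)
    rw [pair_comm r q] at hab
    have hsum := sum_degIn_le (G := G) (l := [z, a, b, d])
      (by simpa using ⟨⟨hza, hzb, hzd⟩, ⟨hab, had⟩, hbd⟩)
    simp only [List.map_cons, List.map_nil, List.sum_cons, List.sum_nil] at hsum
    have hb1 := hone b hbp.1
    omega

theorem Link.symm_adj {x y : V} (h : Link G X Y x y) : G.Adj y x := h.2.2.symm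

/-- A special case of Jackson's theorem on cycles in bipartite graphs, for paths. -/
theorem not_pathFree_of_degIn {m : ℕ} (hm : m = 3 ∨ m = 4) (hXY : Disjoint X Y)
    (hX : m + 1 ≤ X.card) (hY : Y.card + 1 ≤ 2 * m) (hd : ∀ x ∈ X, m ≤ degIn G Y x) :
    ¬ PathFree G (2 * m + 1) := by
  intro hf
  have hne : ∀ x y, x ∈ X → y ∈ Y → x ≠ y := fun x y hx hy h =>
    disjoint_left.1 hXY hx (h ▸ hy)
  rcases hm with rfl | rfl
  · obtain ⟨a, p, b, q, c, r, d, h₁, h₂, hap, hbp, hbq, hcq, hcr, hdr⟩ :=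
      exists_alt4 (m := 3) (by omega) (by omega) hY hd
    have hnd : [a, p, b, q, c, r, d].Nodup := by
      simp only [Link] at *
      grind
    have := hf.length_lt (by omega) _ hnd (by
      simp [hap.2.2, hbp.symm_adj, hbq.2.2, hcq.symm_adj, hcr.2.2, hdr.symm_adj])
    simp at this
  · obtain ⟨a, p, b, q, c, r, d, s, e, h₁, h₂, hap, hbp, hbq, hcq, hcr, hdr, hds, hes⟩ :=
      exists_alt5 hX (by omega) hd
    have hnd : [a, p, b, q, c, r, d, s, e].Nodup := by
      simp only [Link] at *
      grind
    have := hf.length_lt (by omega) _ hnd (by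
      simp [hap.2.2, hbp.symm_adj, hbq.2.2, hcq.symm_adj, hcr.2.2, hdr.symm_adj, hds.2.2,
        hes.symm_adj])
    simp at this

theorem exists_path_of_complete_bipartite {A B : Finset V} {m : ℕ} (hm : m = 3 ∨ m = 4)
    (hAB : Disjoint A B) (hA : m ≤ A.card) (hB : m + 1 ≤ B.card)
    (h : ∀ a ∈ A, ∀ b ∈ B, G.Adj a b) : ¬ PathFree G (2 * m + 1) := by
  obtain ⟨A', hA', hc⟩ := exists_subset_card_eq hA
  refine not_pathFree_of_degIn hm (X := B) (Y := A') (hAB.symm.mono_right hA') hB (by omega)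
    fun b hb => ?_
  rw [degIn, filter_true_of_mem fun a ha => (h a (hA' ha) b hb).symm, hc]

/-- Bipartite Ramsey theorem for two colours and paths on seven or nine vertices. -/
theorem bipartite_ramsey {H : SimpleGraph V} [DecidableRel H.Adj] {A B : Finset V} {m : ℕ}
    (hm : m = 3 ∨ m = 4) (hAB : Disjoint A B) (hA : 2 * m ≤ A.card + 1)
    (hB : 2 * m + 1 ≤ B.card) (h : ∀ a ∈ A, ∀ b ∈ B, G.Adj a b ∨ H.Adj a b)
    (hG : PathFree G (2 * m + 1)) (hH : PathFree H (2 * m + 1)) : False := by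
  obtain ⟨A', hA', hc⟩ := exists_subset_card_eq (show 2 * m - 1 ≤ A.card by omega)
  have hdis : ∀ P : V → Prop, [DecidablePred P] → Disjoint {b ∈ B | P b} A' := fun P _ =>
    (hAB.symm.mono_right hA').mono_left (filter_subset _ _)
  -- Each `b` has a majority colour towards the `2 * m - 1` vertices of `A'`, and one colour is the
  -- majority for at least `m + 1` of them.
  have hcover : B ⊆ {b ∈ B | m ≤ degIn G A' b} ∪ {b ∈ B | m ≤ degIn H A' b} := by
    intro b hb
    have h1 : A' ⊆ {a ∈ A' | G.Adj b a} ∪ {a ∈ A' | H.Adj b a} := fun a ha => by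
      have := h a (hA' ha) b hb
      simp only [mem_union, mem_filter, ha, true_and]
      exact this.imp SimpleGraph.Adj.symm SimpleGraph.Adj.symm
    have h2 : A'.card ≤ degIn G A' b + degIn H A' b :=
      (card_le_card h1).trans (card_union_le _ _)
    simp only [mem_union, mem_filter, hb, true_and]
    omega
  have hsum := (card_le_card hcover).trans (card_union_le _ _)
  rcases le_or_gt (m + 1) (#{b ∈ B | m ≤ degIn G A' b}) with h1 | h1
  · exact not_pathFree_of_degIn hm (hdis _) h1 (by omega) (fun b hb => (mem_filter.1 hb).2) hG
  · exact not_pathFree_of_degIn hm (hdis fun b => m ≤ degIn H A' b) (by omega) (by omega)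
      (fun b hb => (mem_filter.1 hb).2) hH

/-- `X` is a part of `U` without edges to the rest of `U`. -/
def ClosedIn (G : SimpleGraph V) (U X : Finset V) : Prop :=
  X ⊆ U ∧ ∀ x ∈ X, ∀ y ∈ U, y ∉ X → ¬ G.Adj x y

theorem ClosedIn.compl {U X : Finset V} (h : ClosedIn G U X) : ClosedIn G U (U \ X) := by
  refine ⟨sdiff_subset, fun x hx y hy hyX hxy => ?_⟩
  simp only [mem_sdiff, not_and, not_not] at hx hyX
  exact h.2 y (hyX hy) x hx.1 hx.2 hxy.symm

theorem degSum_eq_add {U X : Finset V} (h : ClosedIn G U X) :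
    degSum G U = degSum G X + degSum G (U \ X) := by
  have key : ∀ Y, ClosedIn G U Y → ∑ v ∈ Y, degIn G U v = degSum G Y := fun Y hY => by
    refine sum_congr rfl fun v hv => ?_
    rw [degIn, degIn]
    congr 1
    ext w
    simp only [mem_filter]
    refine ⟨fun hw => ⟨?_, hw.2⟩, fun hw => ⟨hY.1 hw.1, hw.2⟩⟩
    by_contra hwY
    exact hY.2 v hv w hw.1 hwY hw.2
  rw [← key _ h, ← key _ h.compl, degSum, add_comm, sum_sdiff h.1]

/-- A smallest closed set of size at least `N` is connected or splits into two smaller closed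
sets. -/
theorem exists_closedIn_minimal (G : SimpleGraph V) {U : Finset V} {N : ℕ} (hN : N ≤ U.card) :
    ∃ W, ClosedIn G U W ∧ N ≤ W.card ∧ (Conn G W ∨ ∃ X, ClosedIn G U X ∧ ClosedIn G U (W \ X) ∧
      X ⊆ W ∧ ClosedIn G W X ∧ X.card < N ∧ (W \ X).card < N) := by
  classical
  obtain ⟨W, hW, hmin⟩ := exists_min_image (U.powerset.filter fun W => ClosedIn G U W ∧ N ≤ W.card)
    card ⟨U, mem_filter.2 ⟨mem_powerset_self U,
      ⟨Subset.rfl, fun _ _ _ hy hyU => absurd hy hyU⟩, hN⟩⟩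
  simp only [mem_filter, mem_powerset] at hW hmin
  obtain ⟨hWU, hWc, hWN⟩ := hW
  refine ⟨W, hWc, hWN, or_iff_not_imp_left.2 fun hconn => ?_⟩
  simp only [Conn, not_forall, not_exists, not_and] at hconn
  obtain ⟨X, hXW, hXne, hXW', hX⟩ := hconn
  have h1 : ClosedIn G W X := ⟨hXW, fun x hx y hy hyX hxy => hX x hx y hy hyX hxy⟩
  have h2 : ∀ X, ClosedIn G W X → ClosedIn G U X := fun X hX => by
    refine ⟨hX.1.trans hWU, fun x hx y hy hyX hxy => ?_⟩
    by_cases hyW : y ∈ W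
    · exact hX.2 x hx y hyW hyX hxy
    · exact hWc.2 x (hX.1 hx) y hy hyW hxy
  have h3 : ∀ X, ClosedIn G W X → X ≠ W → X.card < N := fun X hX hne => by
    by_contra! hle
    have := hmin X ⟨hX.1.trans hWU, h2 X hX, hle⟩
    exact hne (eq_of_subset_of_card_le hX.1 this)
  refine ⟨X, h2 X h1, h2 _ h1.compl, hXW, h1, h3 X h1 hXW', h3 _ h1.compl fun h => ?_⟩
  obtain ⟨x, hx⟩ := hXne
  have := h.symm ▸ hXW hx
  exact (mem_sdiff.1 this).2 hx

end

/-! ### Upper bounds on the edges of one colour. -/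

section Upper

variable {V : Type*} [DecidableEq V] {G H L : SimpleGraph V} [DecidableRel G.Adj]
  [DecidableRel H.Adj] [DecidableRel L.Adj] {U : Finset V} {m : ℕ}

theorem card_mul_le_degSum_add
    (h : ∀ x ∈ U, ∀ y ∈ U, x ≠ y → G.Adj x y ∨ H.Adj x y ∨ L.Adj x y) :
    U.card * (U.card - 1) ≤ degSum G U + degSum H U + degSum L U := by
  rw [degSum, degSum, degSum, ← sum_add_distrib, ← sum_add_distrib, ← smul_eq_mul]
  refine card_nsmul_le_sum _ _ _ fun v hv => ?_
  rw [← card_erase_of_mem hv]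
  have hsub : U.erase v ⊆ ({w ∈ U | G.Adj v w} ∪ {w ∈ U | H.Adj v w}) ∪ {w ∈ U | L.Adj v w} := by
    intro w hw
    rw [mem_erase] at hw
    have := h v hv w hw.2 hw.1.symm
    simp only [mem_union, mem_filter, hw.2, true_and]
    tauto
  exact (card_le_card hsub).trans ((card_union_le _ _).trans
    (Nat.add_le_add_right (card_union_le _ _) _))

/-- All edges between `X` and its complement have the other two colours; one of the two sides has `2
* m - 1` or `2 * m` vertices, so `bipartite_ramsey` applies. -/
theorem not_closedIn_of_card (hm : m = 3 ∨ m = 4) (hU : U.card = 4 * m + 1)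
    (hH : PathFree H (2 * m + 1)) (hL : PathFree L (2 * m + 1))
    (h : ∀ x ∈ U, ∀ y ∈ U, x ≠ y → G.Adj x y ∨ H.Adj x y ∨ L.Adj x y) {X : Finset V}
    (hX : ClosedIn G U X) (h1 : 2 * m ≤ X.card + 1) (h2 : X.card ≤ 2 * m + 2) : False := by
  have key : ∀ X, ClosedIn G U X → 2 * m ≤ X.card + 1 → X.card ≤ 2 * m → False := by
    intro X hX h1 h2
    refine bipartite_ramsey hm (disjoint_sdiff (s := X) (t := U)) h1 ?_ (fun a ha b hb => ?_) hH hL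
    · rw [card_sdiff_of_subset hX.1]
      omega
    · rw [mem_sdiff] at hb
      exact (h a (hX.1 ha) b hb.1 fun hab => hb.2 (hab ▸ ha)).resolve_left
        (hX.2 a ha b hb.1 hb.2)
  by_cases h3 : X.card ≤ 2 * m
  · exact key X hX h1 h3
  · have := card_sdiff_of_subset hX.1
    exact key _ hX.compl (by omega) (by omega)

theorem card_closedIn_compl {W : Finset V} (hW : ClosedIn G U W) :
    (U \ W).card + W.card = U.card :=
  card_sdiff_add_card_eq_card hW.1

/-- Closed sets have at most four or at least nine vertices. A minimal closed set of at least nine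
cannot split into two of at most four, so it is connected and leaves at most four vertices over. -/
theorem degSum_lt_of_pathFree_seven (hU : U.card = 13) (hG : PathFree G 7) (hH : PathFree H 7)
    (hL : PathFree L 7) (h : ∀ x ∈ U, ∀ y ∈ U, x ≠ y → G.Adj x y ∨ H.Adj x y ∨ L.Adj x y) :
    degSum G U < 52 := by
  have hcl : ∀ X, ClosedIn G U X → X.card < 5 ∨ 8 < X.card := fun X hX => by
    by_contra! hc
    exact not_closedIn_of_card (m := 3) (by omega) hU hH hL h hX (by omega) hc.2
  obtain ⟨W, hW, hWc, hconn | ⟨X, hX, hY, hXW, -, h1, h2⟩⟩ :=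
    exists_closedIn_minimal G (show 9 ≤ U.card by omega)
  · have h1 := degSum_le_of_pathFree_seven hconn (by omega) hG
    have h2 := degSum_le (G := G) (U \ W)
    have h3 := degSum_eq_add hW
    have h4 := card_closedIn_compl hW
    obtain ⟨z, hz⟩ : ∃ z, z = (U \ W).card := ⟨_, rfl⟩
    rw [← hz] at h2 h4
    have h5 : z ≤ 4 := by omega
    interval_cases z <;> omega
  · have h3 := card_sdiff_add_card_eq_card hXW
    have h4 := hcl X hX
    have h5 := hcl _ hY
    omega

/-- The bound 66 is half of `12 * 11`, so applying this to both colours is contradictory. Closed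
sets of four to eight vertices would give a complete bipartite graph in `H`. -/
theorem ramsey_two_colors_nine (hU : U.card = 12) (hG : PathFree G 9) (hH : PathFree H 9)
    (h : ∀ x ∈ U, ∀ y ∈ U, x ≠ y → G.Adj x y ∨ H.Adj x y) : degSum G U < 66 := by
  have hcl : ∀ X, ClosedIn G U X → X.card < 4 ∨ 8 < X.card := by
    have key : ∀ X, ClosedIn G U X → 4 ≤ X.card → X.card ≤ 7 → False := by
      intro X hX h1 h2
      refine exists_path_of_complete_bipartite (m := 4) (G := H) (by omega)
        (disjoint_sdiff (s := X) (t := U)) h1 ?_ (fun a ha b hb => ?_) hH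
      · rw [card_sdiff_of_subset hX.1]
        omega
      · rw [mem_sdiff] at hb
        exact (h a (hX.1 ha) b hb.1 fun hab => hb.2 (hab ▸ ha)).resolve_left
          (hX.2 a ha b hb.1 hb.2)
    intro X hX
    by_contra! hc
    obtain ⟨h1, h2⟩ := hc
    by_cases h3 : X.card ≤ 7
    · exact key X hX h1 h3
    · have := card_sdiff_of_subset hX.1
      exact key _ hX.compl (by omega) (by omega)
  obtain ⟨W, hW, hWc, hconn | ⟨X, hX, hY, hXW, -, h1, h2⟩⟩ :=
    exists_closedIn_minimal G (show 9 ≤ U.card by omega)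
  · have h1 := degSum_le_of_pathFree_nine hconn (by omega) hG
    have h2 := degSum_le (G := G) (U \ W)
    have h3 := degSum_eq_add hW
    have h4 := card_closedIn_compl hW
    obtain ⟨z, hz⟩ : ∃ z, z = (U \ W).card := ⟨_, rfl⟩
    rw [← hz] at h2 h4
    have h5 : z ≤ 3 := by omega
    interval_cases z <;> omega
  · have h3 := card_sdiff_add_card_eq_card hXW
    have h4 := hcl X hX
    have h5 := hcl _ hY
    omega

theorem degSum_lt_of_pathFree_nine (hU : U.card = 17) (hG : PathFree G 9) (hH : PathFree H 9)
    (hL : PathFree L 9) (h : ∀ x ∈ U, ∀ y ∈ U, x ≠ y → G.Adj x y ∨ H.Adj x y ∨ L.Adj x y) :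
    degSum G U < 91 := by
  by_contra! hsum
  have hcl : ∀ X, ClosedIn G U X → X.card < 7 ∨ 10 < X.card := fun X hX => by
    by_contra! hc
    exact not_closedIn_of_card (m := 4) (by omega) hU hH hL h hX (by omega) hc.2
  obtain ⟨W, hW, hWc, hconn | ⟨X, hX, hY, hXW, hXW', h1, h2⟩⟩ :=
    exists_closedIn_minimal G (show 11 ≤ U.card by omega)
  · by_cases hWU : W = U
    · subst hWU
      obtain h1 | h1 | ⟨K, hKU, hK, hd, hmax⟩ :=
        degSum_le_or_core_of_pathFree_nine hconn (by omega) hG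
      · omega
      · omega
      have hind := core_compl_independent hconn hU hG hsum hKU hK hd hmax
      have hT : (W \ K).card = 12 := by rw [card_sdiff_of_subset hKU]; omega
      have hT2 : ∀ x ∈ W \ K, ∀ y ∈ W \ K, x ≠ y → H.Adj x y ∨ L.Adj x y := fun x hx y hy hxy =>
        (h x (mem_sdiff.1 hx).1 y (mem_sdiff.1 hy).1 hxy).resolve_left (hind x hx y hy)
      have h2 := ramsey_two_colors_nine hT hH hL hT2
      have h3 := ramsey_two_colors_nine hT hL hH fun x hx y hy hxy => (hT2 x hx y hy hxy).symm
      have h4 := card_mul_le_degSum_add (G := G) (H := H) (L := L) (U := W \ K)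
        fun x hx y hy hxy => Or.inr (hT2 x hx y hy hxy)
      have h5 : degSum G (W \ K) = 0 :=
        sum_eq_zero fun v hv => degIn_eq_zero fun w hw => hind v hv w hw
      rw [hT] at h4
      omega
    · have h1 := degSum_le_of_pathFree_nine hconn (by omega) hG
      have h2 := degSum_le (G := G) (U \ W)
      have h3 := degSum_eq_add hW
      have h4 := card_closedIn_compl hW
      have h6 := card_lt_card (hW.1.ssubset_of_ne hWU)
      obtain ⟨z, hz⟩ : ∃ z, z = (U \ W).card := ⟨_, rfl⟩
      rw [← hz] at h2 h4
      have h5 : z ≤ 6 := by omega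
      interval_cases z <;> omega
  · have h3 := card_sdiff_add_card_eq_card hXW
    have h4 := hcl X hX
    have h5 := hcl _ hY
    have h6 := hcl _ hW.compl
    have h7 := card_closedIn_compl hW
    have h8 := degSum_eq_add hW
    have h9 := degSum_eq_add hXW'
    have ha := degSum_le (G := G) X
    have hb := degSum_le (G := G) (W \ X)
    have hc := degSum_le (G := G) (U \ W)
    -- Three closed pieces of at most six vertices have degree sum at most 90 in total.
    have hbound : ∀ n ≤ 6, n * (n - 1) ≤ 30 := by decide
    have ha' := hbound X.card (by omega)
    have hb' := hbound (W \ X).card (by omega)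
    have hc' := hbound (U \ W).card (by omega)
    omega

end Upper

/-- Averaging: the degree sums of the three colours add up to at least `n * (n - 1)`. -/
theorem ramseyArrows_of_degSum_lt {n k : ℕ}
    (hlt : ∀ G H L : SimpleGraph (Fin n), ∀ [DecidableRel G.Adj], ∀ [DecidableRel H.Adj],
      ∀ [DecidableRel L.Adj], PathFree G k → PathFree H k → PathFree L k →
      (∀ x ∈ (univ : Finset (Fin n)), ∀ y ∈ (univ : Finset (Fin n)), x ≠ y →
        G.Adj x y ∨ H.Adj x y ∨ L.Adj x y) → 3 * degSum G univ < n * (n - 1)) :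
    RamseyArrows n (fun _ : Fin 3 => SimpleGraph.pathGraph k) := by
  intro C
  by_contra! hcon
  have hf : ∀ i, PathFree (C.labelGraph i) k := fun i =>
    pathFree_of_not_isContained (not_nonempty_iff.2 (hcon i))
  have hcov : ∀ x y : Fin n, x ≠ y → (C.labelGraph 0).Adj x y ∨ (C.labelGraph 1).Adj x y ∨
      (C.labelGraph 2).Adj x y := fun x y hxy => by
    simp only [SimpleGraph.TopEdgeLabeling.labelGraph_adj]
    generalize hi : C.get x y hxy = i
    fin_cases i
    · exact Or.inl ⟨hxy, hi⟩
    · exact Or.inr (Or.inl ⟨hxy, hi⟩)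
    · exact Or.inr (Or.inr ⟨hxy, hi⟩)
  have h0 := hlt _ _ _ (hf 0) (hf 1) (hf 2) fun x _ y _ hxy => hcov x y hxy
  have h1 := hlt _ _ _ (hf 1) (hf 0) (hf 2) fun x _ y _ hxy => by
    have := hcov x y hxy
    tauto
  have h2 := hlt _ _ _ (hf 2) (hf 0) (hf 1) fun x _ y _ hxy => by
    have := hcov x y hxy
    tauto
  have h3 := card_mul_le_degSum_add fun x (_ : x ∈ univ) y (_ : y ∈ univ) hxy => hcov x y hxy
  rw [card_univ, Fintype.card_fin] at h3
  omega

/-! ### The colouring for the lower bound. -/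

/-- The three bipartitions of `{0, 1, 2, 3}` into pairs. -/
def side (i : Fin 3) (b : ℕ) : ℕ :=
  if i = 0 then b / 2 else if i = 1 then b % 2 else (b / 2 + b % 2) % 2

/-- A colour `i` for which `b` and `c` are on the same side of the `i`-th bipartition. -/
def pairColor (b c : ℕ) : Fin 3 :=
  if b / 2 = c / 2 then 0 else if b % 2 = c % 2 then 1 else 2

theorem pairColor_comm (b c : ℕ) : pairColor b c = pairColor c b := by
  simp only [pairColor, eq_comm]

theorem side_pairColor {b c : ℕ} (hb : b < 4) (hc : c < 4) :
    side (pairColor b c) b = side (pairColor b c) c := by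
  interval_cases b <;> interval_cases c <;> decide

/-- A bit that together with the side determines an element of `{0, 1, 2, 3}`. -/
def bit (i : Fin 3) (b : ℕ) : ℕ :=
  if i = 0 then b % 2 else b / 2

theorem eq_of_side_bit {i : Fin 3} {b c : ℕ} (hb : b < 4) (hc : c < 4)
    (h : side i b = side i c) (h' : bit i b = bit i c) : b = c := by
  fin_cases i <;> simp [side, bit] at h h' <;> omega

theorem bit_lt {i : Fin 3} {b : ℕ} (hb : b < 4) : bit i b < 2 := by
  fin_cases i <;> simp [bit] <;> omega

/-- The block of a vertex is its quotient by `m`. A path of colour `i` never changes sides in the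
`i`-th bipartition of the blocks, and a side consists of two blocks with at most `m` vertices each.
-/
theorem not_ramseyArrows {n m : ℕ} (hm : 0 < m) (hn : n ≤ 4 * m) :
    ¬ RamseyArrows n (fun _ : Fin 3 => SimpleGraph.pathGraph (2 * m + 1)) := by
  intro h
  obtain ⟨i, ⟨f⟩⟩ := h (SimpleGraph.EdgeLabeling.mk (fun x y _ => pairColor (x / m) (y / m))
    fun x y _ => pairColor_comm _ _)
  have hblock : ∀ v : Fin n, (v : ℕ) / m < 4 := fun v =>
    (Nat.div_lt_iff_lt_mul hm).2 (v.2.trans_le hn)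
  have hside : ∀ j, ∀ hj : j < 2 * m + 1, side i ((f ⟨j, hj⟩ : Fin n) / m) =
      side i ((f ⟨0, by omega⟩ : Fin n) / m) := by
    intro j
    induction j with
    | zero => exact fun _ => rfl
    | succ j ih =>
      intro hj
      rw [← ih (by omega)]
      have hadj : (SimpleGraph.pathGraph (2 * m + 1)).Adj ⟨j + 1, hj⟩ ⟨j, by omega⟩ := by
        simp [SimpleGraph.pathGraph_adj]
      obtain ⟨_, hc⟩ := (SimpleGraph.TopEdgeLabeling.labelGraph_adj _ _).1 (f.toHom.map_adj hadj)
      rw [SimpleGraph.EdgeLabeling.get_mk] at hc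
      have := side_pairColor (hblock (f ⟨j + 1, hj⟩)) (hblock (f ⟨j, by omega⟩))
      rwa [show pairColor ((f ⟨j + 1, hj⟩ : Fin n) / m) ((f ⟨j, by omega⟩ : Fin n) / m) = i from hc]
        at this
  let g : Fin (2 * m + 1) → Fin 2 × Fin m := fun j =>
    (⟨bit i ((f j : Fin n) / m), bit_lt (hblock _)⟩, ⟨(f j : Fin n) % m, Nat.mod_lt _ hm⟩)
  have hg : Function.Injective g := fun j k hjk => by
    simp only [g, Prod.mk.injEq, Fin.mk.injEq] at hjk
    have h1 := eq_of_side_bit (hblock _) (hblock _)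
      ((hside j j.2).trans (hside k k.2).symm) hjk.1
    refine f.injective (Fin.ext ?_)
    change ((f j : Fin n) : ℕ) = (f k : Fin n)
    rw [← Nat.div_add_mod (f j : Fin n) m, ← Nat.div_add_mod (f k : Fin n) m]
    exact congrArg₂ (fun a b => m * a + b) h1 hjk.2
  have := Fintype.card_le_of_injective g hg
  simp only [Fintype.card_fin, Fintype.card_prod] at this
  omega

theorem isDiagonalRamseyNumber_pathGraph {m : ℕ} (hm : 0 < m)
    (h : RamseyArrows (4 * m + 1) (fun _ : Fin 3 => SimpleGraph.pathGraph (2 * m + 1))) :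
    IsDiagonalRamseyNumber 3 (SimpleGraph.pathGraph (2 * m + 1)) (4 * m + 1) :=
  ⟨h, fun n hn => by
    by_contra! hlt
    exact not_ramseyArrows hm (by omega) hn⟩

end RamseyPath

theorem corollary7 :
    IsDiagonalRamseyNumber 3 (SimpleGraph.pathGraph 7) 13 ∧
      IsDiagonalRamseyNumber 3 (SimpleGraph.pathGraph 9) 17 := by
  refine ⟨RamseyPath.isDiagonalRamseyNumber_pathGraph (m := 3) (by norm_num)
    (RamseyPath.ramseyArrows_of_degSum_lt ?_), RamseyPath.isDiagonalRamseyNumber_pathGraph (m := 4)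
    (by norm_num) (RamseyPath.ramseyArrows_of_degSum_lt ?_)⟩
  · intro G H L _ _ _ hG hH hL h
    have := RamseyPath.degSum_lt_of_pathFree_seven (by simp) hG hH hL h
    omega
  · intro G H L _ _ _ hG hH hL h
    have := RamseyPath.degSum_lt_of_pathFree_nine (by simp) hG hH hL h
    omega
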